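/- **Conventions.** Fix an infinite set $\mathit{Var}$ of variables. A map $f:[0,1]^n\to[0,1]$ is an *ultra-metric map* if $f(x_1,\dots,x_n)=0\iff x_1=\dots=x_n=0$ and $f$ distributes over componentwise $\max$. A (continuous) *term metric* $m$ for a signature $\Sigma$ (function symbols with finite arities) assigns to each $n$-ary symbol $F$ a continuous ultra-metric map $F_m:[0,1]^n\to[0,1]$. It induces an ultrametric $d_m$ on the finite terms over $\Sigma$ and $\mathit{Var}$: $d_m(t,t)=0$, $d_m(t,u)=1$ if $t,u$ have different root symbols, and $d_m(F(\vec t),F(\vec u))=F_m(d_m(t_1,u_1),\dots,d_m(t_n,u_n))$. The set $\mathrm{Ter}(m)$ of *infinitary terms* is the metric completion; term formation and the application $\bar\theta$ of substitutions $\theta:\mathit{Var}\to\mathrm{Ter}(m)$ extend to it by continuity, and a context $C[\ ]$ is an infinitary term with a hole at one (finite) position. An *infinitary term rewriting system* (iTRS) is a triple $(\Sigma,m,R)$ where $R\subseteq \mathrm{Ter}(m)\times\mathrm{Ter}(m)$ is a set of rules $l\to r$ such that $l$ is not a variable and all variables of $r$ occur in $l$. Its rewrite steps are $C[\bar\theta(l)]\to_R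 C[\bar\theta(r)]$. It is *non-collapsing* if no right-hand side is a variable. A *reduction sequence* of length an ordinal $\alpha$ is a continuous map $f:\alpha\to\mathrm{Ter}(m)$ ($\alpha$ with the order topology) with $f(\beta)\to_R f(\beta+1)$ whenever $\beta+1<\alpha$. The iTRS is *convergent* if every reduction sequence whose length $\alpha$ is a limit ordinal extends to a continuous map $\alpha+1\to\mathrm{Ter}(m)$. The *indirected version* of $(\Sigma,m,R)$ extends $\Sigma$ by a fresh unary symbol $I$ with $I_m(x)=x$ and has the rules $l\to I(r)$ for all $(l\to r)\in R$, together with $I(x)\to x$. An iTRS is *strongly convergent* if its indirected version is convergent. The *disjoint union* $R+S$ of two iTRSs has the disjoint union of their signatures, with the ultra-metric maps of all symbols unchanged, and all rules of both systems. **Theorem.** Let $R$ and $S$ be non-collapsing, strongly convergent iTRSs, each over an arbitrary continuous term metric. If $R+S$ is convergent, then $R+S$ is strongly convergent. -/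

import Mathlib

universe u

open Filter Topology

noncomputable section

namespace InfRewriting

/-! ### Reduction sequences over topological spaces -/

section Sequences

variable {S : Type u} [TopologicalSpace S]

/-- `f` restricted to the ordinals below `α` is a sequence of length `α`,
i.e. a continuous function `α → S`; the values of `f` from `α` on are irrelevant. -/
def IsSequence (α : Ordinal.{u}) (f : Ordinal.{u} → S) : Prop :=
  ContinuousOn f (Set.Iio α)

/-- `f` is a reduction sequence of length `α` for the relation `r`. -/
structure IsReductionSequence (r : S → S → Prop) (α : Ordinal.{u}) (f : Ordinal.{u} → S) :
    Prop where
  isSequence : IsSequence α f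
  step : ∀ β : Ordinal.{u}, β + 1 < α → r (f β) (f (β + 1))

/-- The sequence `f` of length `α` converges: it extends to a sequence of length `α + 1`. -/
def SequenceConverges (α : Ordinal.{u}) (f : Ordinal.{u} → S) : Prop :=
  ∃ g : Ordinal.{u} → S, IsSequence (α + 1) g ∧ ∀ γ < α, g γ = f γ

/-- A topological abstract reduction system is convergent if all its open reduction sequences
(those whose length is a limit ordinal) converge. -/
def IsConvergent (r : S → S → Prop) : Prop :=
  ∀ (α : Ordinal.{u}) (f : Ordinal.{u} → S),
    Order.IsSuccLimit α → IsReductionSequence r α f → SequenceConverges α f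

end Sequences

/-! ### Term metrics -/

/-- `n`-ary ultra-metric maps on the unit interval. -/
structure IsUltrametricMap {n : ℕ} (f : (Fin n → unitInterval) → unitInterval) : Prop where
  eq_zero_iff : ∀ x, f x = 0 ↔ ∀ i, x i = 0
  map_sup : ∀ x y, f (x ⊔ y) = f x ⊔ f y

theorem IsUltrametricMap.monotone {n : ℕ} {f : (Fin n → unitInterval) → unitInterval}
    (hf : IsUltrametricMap f) : Monotone f := by
  intro x y h
  have := hf.map_sup x y
  rw [sup_eq_right.2 h] at this
  rw [this]
  exact le_sup_left

/-- A signature (a set of function symbols with arities) together with a continuous term metric: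
every function symbol is interpreted on `[0,1]` by a continuous ultra-metric map of its arity. -/
structure MetricSignature where
  Symbol : Type u
  arity : Symbol → ℕ
  umm : ∀ F : Symbol, (Fin (arity F) → unitInterval) → unitInterval
  isUltrametricMap : ∀ F, IsUltrametricMap (umm F)
  continuous_umm : ∀ F, Continuous (umm F)

/-- Finite terms over a signature, with variables in `V`. -/
inductive FinTerm (M : MetricSignature.{u}) (V : Type u) : Type u
  | var (x : V) : FinTerm M V
  | app (F : M.Symbol) (ts : Fin (M.arity F) → FinTerm M V) : FinTerm M V

namespace FinTerm

variable {M : MetricSignature.{u}} {V : Type u}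

open Classical in
/-- The distance `d_m` on finite terms, with values in `[0,1]`. (That `d_m(t,t) = 0` also for
terms `t = F(t₁,…,tₙ)` is `tdist_self`.) -/
def tdist : FinTerm M V → FinTerm M V → unitInterval
  | var x, var y => if x = y then 0 else 1
  | app F ts, app G us =>
    if h : F = G then M.umm F (fun i => tdist (ts i) (us (Fin.cast (congrArg M.arity h) i))) else 1
  | var _, app _ _ => 1
  | app _ _, var _ => 1

theorem tdist_app (F : M.Symbol) (ts us : Fin (M.arity F) → FinTerm M V) :
    tdist (app F ts) (app F us) = M.umm F (fun i => tdist (ts i) (us i)) := by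
  simp [tdist]

theorem tdist_app_ne {F G : M.Symbol} (h : F ≠ G) (ts : Fin (M.arity F) → FinTerm M V)
    (us : Fin (M.arity G) → FinTerm M V) : tdist (app F ts) (app G us) = 1 := by
  simp [tdist, h]

theorem tdist_eq_zero : ∀ {t u : FinTerm M V}, tdist t u = 0 ↔ t = u := by
  intro t
  induction t with
  | var x =>
    intro u
    cases u with
    | var y => by_cases h : x = y <;> simp [tdist, h]
    | app G us => simp [tdist]
  | app F ts ih =>
    intro u
    cases u with
    | var y => simp [tdist]
    | app G us =>
      by_cases h : F = G
      · subst h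
        rw [tdist_app, (M.isUltrametricMap F).eq_zero_iff]
        simp only [ih, app.injEq, heq_eq_eq, true_and]
        exact funext_iff.symm
      · rw [tdist_app_ne h]
        simp [h]

theorem tdist_self (t : FinTerm M V) : tdist t t = 0 := tdist_eq_zero.2 rfl

theorem tdist_comm : ∀ t u : FinTerm M V, tdist t u = tdist u t := by
  intro t
  induction t with
  | var x =>
    intro u
    cases u with
    | var y =>
      by_cases h : x = y
      · rw [h]
      · simp [tdist, h, Ne.symm h]
    | app G us => simp [tdist]
  | app F ts ih =>
    intro u
    cases u with
    | var y => simp [tdist]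
    | app G us =>
      by_cases h : F = G
      · subst h
        simp [tdist_app, ih]
      · rw [tdist_app_ne h, tdist_app_ne (Ne.symm h)]

theorem tdist_le_sup : ∀ t u v : FinTerm M V, tdist t v ≤ tdist t u ⊔ tdist u v := by
  have key : ∀ a b : unitInterval, a ≤ 1 ⊔ b := fun a b => le_trans unitInterval.le_one' le_sup_left
  have key' : ∀ a b : unitInterval, a ≤ b ⊔ 1 := fun a b => le_trans unitInterval.le_one' le_sup_right
  intro t
  induction t with
  | var x =>
    intro u v
    cases u with
    | app G us => exact key _ _
    | var y =>
      by_cases h : x = y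
      · subst h
        exact le_sup_right
      · have : tdist (M := M) (var x) (var y) = 1 := by simp [tdist, h]
        rw [this]
        exact key _ _
  | app F ts ih =>
    intro u v
    cases u with
    | var y => exact key _ _
    | app G us =>
      by_cases h : F = G
      · subst h
        cases v with
        | var z => exact key' _ _
        | app H vs =>
          by_cases h' : F = H
          · subst h'
            simp only [tdist_app]
            rw [← (M.isUltrametricMap F).map_sup]
            exact (M.isUltrametricMap F).monotone fun i => ih i _ _
          · rw [tdist_app_ne h' us vs]
            exact key' _ _
      · rw [tdist_app_ne h]
        exact key _ _

instance : MetricSpace (FinTerm M V) where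
  dist t u := (tdist t u : ℝ)
  dist_self t := by simp [tdist_self]
  dist_comm t u := by rw [tdist_comm]
  dist_triangle t u v := by
    have h : ((tdist t v : unitInterval) : ℝ) ≤ ((tdist t u ⊔ tdist u v : unitInterval) : ℝ) :=
      tdist_le_sup t u v
    refine h.trans ?_
    have h1 := unitInterval.nonneg (tdist t u)
    have h2 := unitInterval.nonneg (tdist u v)
    rcases le_total (tdist t u) (tdist u v) with h3 | h3
    · rw [sup_eq_right.2 h3]
      linarith
    · rw [sup_eq_left.2 h3]
      linarith
  eq_of_dist_eq_zero h := tdist_eq_zero.1 (Subtype.ext h)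

theorem dist_eq (t u : FinTerm M V) : dist t u = (tdist t u : ℝ) := rfl

/-- An ultra-metric map is small as soon as all its arguments are small. -/
theorem umm_small (F : M.Symbol) {ε : ℝ} (hε : 0 < ε) :
    ∃ δ > 0, ∀ x : Fin (M.arity F) → unitInterval,
      (∀ i, (x i : ℝ) < δ) → (M.umm F x : ℝ) < ε := by
  have h0 : M.umm F 0 = 0 := ((M.isUltrametricMap F).eq_zero_iff 0).2 fun _ => rfl
  have hc := (Metric.continuous_iff.1 (M.continuous_umm F)) 0 ε hε
  obtain ⟨δ, hδ, h⟩ := hc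
  refine ⟨δ, hδ, fun x hx => ?_⟩
  have := h x ((dist_pi_lt_iff hδ).2 fun i => ?_)
  · rw [h0, Subtype.dist_eq, Real.dist_eq] at this
    simpa [abs_of_nonneg (unitInterval.nonneg _)] using this
  · rw [Subtype.dist_eq, Real.dist_eq]
    simpa [abs_of_nonneg (unitInterval.nonneg _)] using hx i

theorem uniformContinuous_app (F : M.Symbol) :
    UniformContinuous (app F : (Fin (M.arity F) → FinTerm M V) → FinTerm M V) := by
  rw [Metric.uniformContinuous_iff]
  intro ε hε
  obtain ⟨δ, hδ, h⟩ := umm_small F hε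
  refine ⟨δ, hδ, fun ts us hd => ?_⟩
  rw [dist_eq, tdist_app]
  exact h _ fun i => (dist_pi_lt_iff hδ).1 hd i

end FinTerm

/-! ### Infinitary terms -/

/-- The infinitary terms: the metric completion of the finite terms under `d_m`. -/
abbrev Term (M : MetricSignature.{u}) (V : Type u) : Type u :=
  UniformSpace.Completion (FinTerm M V)

namespace Term

variable {M : MetricSignature.{u}} {V : Type u}

/-- Variables as infinitary terms. -/
def var (x : V) : Term M V := ((FinTerm.var x : FinTerm M V) : Term M V)

theorem isDenseInducing_coe_pi (n : ℕ) :
    IsDenseInducing (fun (ts : Fin n → FinTerm M V) (i : Fin n) => (ts i : Term M V)) where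
  toIsInducing := Topology.IsInducing.piMap fun _ =>
    (UniformSpace.Completion.isUniformInducing_coe (FinTerm M V)).isInducing
  dense := DenseRange.piMap fun _ => UniformSpace.Completion.denseRange_coe

theorem isUniformInducing_coe_pi (n : ℕ) :
    IsUniformInducing (fun (ts : Fin n → FinTerm M V) (i : Fin n) => (ts i : Term M V)) :=
  (Isometry.piMap (fun _ => ((↑) : FinTerm M V → Term M V))
    fun _ => UniformSpace.Completion.coe_isometry).isUniformInducing

/-- The term-forming operation of the function symbol `F` on infinitary terms: the continuous
extension of that on finite terms. -/
def app (F : M.Symbol) : (Fin (M.arity F) → Term M V) → Term M V :=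
  (isDenseInducing_coe_pi (M.arity F)).extend fun ts => ((FinTerm.app F ts : FinTerm M V) : Term M V)

theorem uniformContinuous_app (F : M.Symbol) :
    UniformContinuous (app F : (Fin (M.arity F) → Term M V) → Term M V) :=
  uniformContinuous_uniformly_extend (isUniformInducing_coe_pi _) (isDenseInducing_coe_pi _).dense
    ((UniformSpace.Completion.uniformContinuous_coe _).comp (FinTerm.uniformContinuous_app F))

theorem app_coe (F : M.Symbol) (ts : Fin (M.arity F) → FinTerm M V) :
    app F (fun i => (ts i : Term M V)) = ((FinTerm.app F ts : FinTerm M V) : Term M V) :=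
  uniformly_extend_of_ind (isUniformInducing_coe_pi _) (isDenseInducing_coe_pi _).dense
    ((UniformSpace.Completion.uniformContinuous_coe _).comp (FinTerm.uniformContinuous_app F)) ts

theorem dist_le_one (t u : Term M V) : dist t u ≤ 1 := by
  induction t, u using UniformSpace.Completion.induction_on₂ with
  | hp => exact isClosed_le (by fun_prop) continuous_const
  | ih t u =>
    rw [UniformSpace.Completion.dist_eq, FinTerm.dist_eq]
    exact unitInterval.le_one _

/-- The distance of infinitary terms as an element of `[0,1]`. -/
def tdist (t u : Term M V) : unitInterval := ⟨dist t u, dist_nonneg, dist_le_one t u⟩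

theorem tdist_coe (t u : FinTerm M V) : tdist (t : Term M V) u = FinTerm.tdist t u :=
  Subtype.ext (UniformSpace.Completion.dist_eq t u)

theorem continuous_tdist : Continuous fun p : Term M V × Term M V => tdist p.1 p.2 :=
  Continuous.subtype_mk (by fun_prop) _

theorem tdist_app (F : M.Symbol) (ts us : Fin (M.arity F) → Term M V) :
    tdist (app F ts) (app F us) = M.umm F (fun i => tdist (ts i) (us i)) := by
  have hd := (isDenseInducing_coe_pi (M := M) (V := V) (M.arity F)).dense
  have hc : Continuous (app F : (Fin (M.arity F) → Term M V) → Term M V) :=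
    (uniformContinuous_app F).continuous
  have := (hd.prodMap hd).equalizer
    (g := fun p => tdist (app F p.1) (app F p.2))
    (h := fun p => M.umm F (fun i => tdist (p.1 i) (p.2 i)))
    (continuous_tdist.comp ((hc.comp continuous_fst).prodMk (hc.comp continuous_snd)))
    ((M.continuous_umm F).comp (continuous_pi fun i =>
      Continuous.subtype_mk (((continuous_apply i).comp continuous_fst).dist
        ((continuous_apply i).comp continuous_snd)) _))
    (by
      funext p
      simp only [Function.comp, Prod.map, app_coe, tdist_coe, FinTerm.tdist_app])
  exact congrFun this (ts, us)

theorem app_injective (F : M.Symbol) :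
    Function.Injective (app F : (Fin (M.arity F) → Term M V) → Term M V) := by
  intro ts us h
  have h0 : tdist (app F ts) (app F us) = 0 := by
    rw [h]
    exact Subtype.ext (dist_self _)
  rw [tdist_app, (M.isUltrametricMap F).eq_zero_iff] at h0
  funext i
  exact dist_eq_zero.1 (congrArg Subtype.val (h0 i))

theorem dist_app_ne {F G : M.Symbol} (h : F ≠ G) (ts : Fin (M.arity F) → Term M V)
    (us : Fin (M.arity G) → Term M V) : dist (app F ts) (app G us) = 1 := by
  have hc : ∀ F : M.Symbol, Continuous (app F : (Fin (M.arity F) → Term M V) → Term M V) :=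
    fun F => (uniformContinuous_app F).continuous
  have := ((isDenseInducing_coe_pi (M := M) (V := V) (M.arity F)).dense.prodMap
      (isDenseInducing_coe_pi (M := M) (V := V) (M.arity G)).dense).equalizer
    (g := fun p => dist (app F p.1) (app G p.2)) (h := fun _ => (1 : ℝ))
    (((hc F).comp continuous_fst).dist ((hc G).comp continuous_snd)) continuous_const
    (by
      funext p
      simp only [Function.comp, Prod.map, app_coe, UniformSpace.Completion.dist_eq,
        FinTerm.dist_eq, FinTerm.tdist_app_ne h]
      rfl)
  exact congrFun this (ts, us)

theorem dist_var_app (x : V) (F : M.Symbol) (ts : Fin (M.arity F) → Term M V) :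
    dist (var x) (app F ts) = 1 := by
  have hc : Continuous (app F : (Fin (M.arity F) → Term M V) → Term M V) :=
    (uniformContinuous_app F).continuous
  have := (isDenseInducing_coe_pi (M := M) (V := V) (M.arity F)).dense.equalizer
    (g := fun ts => dist (var x) (app F ts)) (h := fun _ => (1 : ℝ))
    (continuous_const.dist hc) continuous_const
    (by
      funext ts
      simp only [Function.comp, var, app_coe, UniformSpace.Completion.dist_eq, FinTerm.dist_eq]
      rfl)
  exact congrFun this ts

theorem app_inj_symbol {F G : M.Symbol} {ts : Fin (M.arity F) → Term M V}
    {us : Fin (M.arity G) → Term M V} (h : app F ts = app G us) : F = G := by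
  by_contra hne
  have := dist_app_ne hne ts us
  rw [h, dist_self] at this
  exact zero_ne_one this

theorem var_ne_app (x : V) (F : M.Symbol) (ts : Fin (M.arity F) → Term M V) :
    (var x : Term M V) ≠ app F ts := by
  intro h
  have := dist_var_app x F ts
  rw [h, dist_self] at this
  exact zero_ne_one this

theorem var_injective : Function.Injective (var : V → Term M V) := fun _ _ h =>
  FinTerm.var.inj (UniformSpace.Completion.coe_injective _ h)

theorem isClosed_range_app (F : M.Symbol) :
    IsClosed (Set.range (app F : (Fin (M.arity F) → Term M V) → Term M V)) := by
  have hu := M.isUltrametricMap F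
  have hind : IsUniformInducing (app F : (Fin (M.arity F) → Term M V) → Term M V) := by
    rw [Metric.isUniformInducing_iff]
    refine ⟨uniformContinuous_app F, fun δ hδ => ?_⟩
    let e : unitInterval := ⟨min δ 1, (lt_min hδ one_pos).le, min_le_right _ _⟩
    let x : Fin (M.arity F) → (Fin (M.arity F) → unitInterval) := fun i => Pi.single i e
    have hx : ∀ i, 0 < M.umm F (x i) := fun i => by
      refine unitInterval.pos_iff_ne_zero.2 fun h => ?_
      have := (hu.eq_zero_iff _).1 h i
      simp only [x, Pi.single_eq_same] at this
      exact (lt_min hδ one_pos).ne' (congrArg Subtype.val this)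
    obtain ⟨ε, hε, hle⟩ : ∃ ε : ℝ, 0 < ε ∧ ∀ i, ε ≤ (M.umm F (x i) : ℝ) := by
      rcases isEmpty_or_nonempty (Fin (M.arity F)) with hE | hE
      · exact ⟨1, one_pos, fun i => hE.elim i⟩
      · obtain ⟨i, hi⟩ := Finite.exists_min fun i => (M.umm F (x i) : ℝ)
        exact ⟨_, hx i, hi⟩
    refine ⟨ε, hε, fun {ts us} h => (dist_pi_lt_iff hδ).2 fun i => ?_⟩
    by_contra! hge
    have h1 : M.umm F (x i) ≤ tdist (app F ts) (app F us) := by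
      rw [tdist_app]
      refine hu.monotone fun j => ?_
      by_cases hj : j = i
      · subst hj
        simp only [x, Pi.single_eq_same]
        exact show min δ 1 ≤ dist (ts j) (us j) from (min_le_left δ 1).trans hge
      · simp only [x, Pi.single_eq_of_ne hj]
        exact unitInterval.nonneg'
    exact absurd h (not_lt.2 ((hle i).trans h1))
  exact (completeSpace_coe_iff_isComplete.1 (by
    exact hind.isComplete_range.completeSpace_coe)).isClosed

/-- Every infinitary term is a variable or of the form `F(t₁,…,tₙ)`. -/
theorem eq_var_or_app (t : Term M V) : (∃ x, t = var x) ∨ ∃ F ts, t = app F ts := by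
  have hclose : ∀ A : Set (Term M V), IsClosed A →
      (∀ s : FinTerm M V, dist (s : Term M V) t < 1 → (s : Term M V) ∈ A) → t ∈ A := by
    intro A hA h
    rw [← hA.closure_eq, Metric.mem_closure_iff]
    intro ε hε
    obtain ⟨s, hs⟩ := UniformSpace.Completion.denseRange_coe.exists_dist_lt t
      (lt_min hε one_pos)
    refine ⟨s, h s ?_, hs.trans_le (min_le_left _ _)⟩
    rw [dist_comm]
    exact hs.trans_le (min_le_right _ _)
  have hult : ∀ s s' : FinTerm M V, dist (s : Term M V) t < 1 → dist (s' : Term M V) t < 1 →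
      FinTerm.tdist s s' < 1 := by
    intro s s' h h'
    obtain ⟨r, hr⟩ := UniformSpace.Completion.denseRange_coe.exists_dist_lt t
      (show 0 < min (1 - dist (s : Term M V) t) (1 - dist (s' : Term M V) t) from
        lt_min (by linarith) (by linarith))
    have h1 : dist (s : Term M V) r < 1 := by
      have := dist_triangle (s : Term M V) t r
      have := hr.trans_le (min_le_left _ _)
      linarith
    have h2 : dist (r : Term M V) s' < 1 := by
      have := dist_triangle (r : Term M V) t s'
      have := hr.trans_le (min_le_right _ _)
      rw [dist_comm (r : Term M V) t, dist_comm t (s' : Term M V)] at *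
      linarith
    rw [UniformSpace.Completion.dist_eq, FinTerm.dist_eq] at h1 h2
    exact (FinTerm.tdist_le_sup s r s').trans_lt (max_lt h1 h2)
  obtain ⟨s, hs⟩ := UniformSpace.Completion.denseRange_coe.exists_dist_lt t one_pos
  rw [dist_comm] at hs
  cases s with
  | var x =>
    left
    refine ⟨x, hclose {var x} isClosed_singleton fun s' hs' => ?_⟩
    have := hult _ _ hs hs'
    cases s' with
    | app G us => exact absurd this (lt_irrefl _)
    | var y =>
      by_cases h : x = y
      · subst h
        rfl
      · simp [FinTerm.tdist, h] at this
  | app F ts =>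
    right
    have : t ∈ Set.range (app F) := by
      refine hclose _ (isClosed_range_app F) fun s' hs' => ?_
      have := hult _ _ hs hs'
      cases s' with
      | var y => exact absurd this (lt_irrefl _)
      | app G us =>
        by_cases h : F = G
        · subst h
          exact ⟨_, app_coe F us⟩
        · rw [FinTerm.tdist_app_ne h] at this
          exact absurd this (lt_irrefl _)
    obtain ⟨us, hus⟩ := this
    exact ⟨F, us, hus.symm⟩

/-- The variable `x` occurs in the infinitary term: it is its subterm at some (finite) position. -/
inductive Occurs (x : V) : Term M V → Prop
  | var : Occurs x (var x)
  | app (F : M.Symbol) (ts : Fin (M.arity F) → Term M V) (i : Fin (M.arity F)) :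
      Occurs x (ts i) → Occurs x (app F ts)

end Term

/-- The value of a finite term under a substitution of infinitary terms for variables. -/
def FinTerm.eval {M : MetricSignature.{u}} {V : Type u} (θ : V → Term M V) :
    FinTerm M V → Term M V
  | .var x => θ x
  | .app F ts => Term.app F fun i => FinTerm.eval θ (ts i)

namespace Term

variable {M : MetricSignature.{u}} {V : Type u}

/-- The application of a substitution `θ` to infinitary terms: the unique continuous extension
of `FinTerm.eval θ` to the completion (which exists by `uniformContinuous_eval`). -/
def subst (θ : V → Term M V) : Term M V → Term M V :=
  UniformSpace.Completion.extension (FinTerm.eval θ)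

theorem tdist_eval_le (θ : V → Term M V) :
    ∀ t u : FinTerm M V, tdist (t.eval θ) (u.eval θ) ≤ FinTerm.tdist t u := by
  intro t
  induction t with
  | var x =>
    intro u
    cases u with
    | app G us => exact unitInterval.le_one'
    | var y =>
      by_cases h : x = y
      · subst h
        rw [FinTerm.tdist_self]
        exact le_of_eq (Subtype.ext (dist_self _))
      · have : FinTerm.tdist (M := M) (FinTerm.var x) (FinTerm.var y) = 1 := by
          simp [FinTerm.tdist, h]
        rw [this]
        exact unitInterval.le_one'
  | app F ts ih =>
    intro u
    cases u with
    | var y => exact unitInterval.le_one'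
    | app G us =>
      by_cases h : F = G
      · subst h
        rw [FinTerm.tdist_app, FinTerm.eval, FinTerm.eval, tdist_app]
        exact (M.isUltrametricMap F).monotone fun i => ih i _
      · rw [FinTerm.tdist_app_ne h]
        exact unitInterval.le_one'

theorem uniformContinuous_eval (θ : V → Term M V) :
    UniformContinuous (FinTerm.eval θ : FinTerm M V → Term M V) :=
  (LipschitzWith.of_dist_le_mul (K := 1) fun t u => by
    rw [NNReal.coe_one, one_mul]
    exact tdist_eval_le θ t u).uniformContinuous

end Term

/-- Contexts over infinitary terms: a term with a hole at one (finite) position. In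
`app F i ts C` the hole lies in the `i`-th argument, and the term `ts i` is ignored. -/
inductive Context (M : MetricSignature.{u}) (V : Type u) : Type u
  | hole : Context M V
  | app (F : M.Symbol) (i : Fin (M.arity F)) (ts : Fin (M.arity F) → Term M V)
      (C : Context M V) : Context M V

/-- Context application `C[t]`. -/
def Context.fill {M : MetricSignature.{u}} {V : Type u} : Context M V → Term M V → Term M V
  | .hole, t => t
  | .app F i ts C, t => Term.app F (Function.update ts i (C.fill t))

/-! ### Metric signature morphisms -/

/-- A metric signature morphism: a map of function symbols that preserves arities and
ultra-metric maps. -/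
structure MetricSignature.Hom (M N : MetricSignature.{u}) where
  toFun : M.Symbol → N.Symbol
  arity_eq : ∀ F, N.arity (toFun F) = M.arity F
  umm_eq : ∀ F x, N.umm (toFun F) x = M.umm F (fun i => x (Fin.cast (arity_eq F).symm i))

/-- The translation of finite terms along a metric signature morphism. -/
def FinTerm.map {M N : MetricSignature.{u}} {V : Type u} (σ : M.Hom N) :
    FinTerm M V → FinTerm N V
  | .var x => .var x
  | .app F ts => .app (σ.toFun F) fun i => FinTerm.map σ (ts (Fin.cast (σ.arity_eq F) i))

theorem FinTerm.lipschitz_map {M N : MetricSignature.{u}} {V : Type u} (σ : M.Hom N) :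
    LipschitzWith 1 (FinTerm.map σ : FinTerm M V → FinTerm N V) := by
  refine LipschitzWith.of_dist_le_mul fun t u => ?_
  rw [NNReal.coe_one, one_mul]
  suffices h : ∀ t u : FinTerm M V, tdist (t.map σ) (u.map σ) ≤ tdist t u from h t u
  intro t
  induction t with
  | var x =>
    intro u
    cases u with
    | app G us => exact unitInterval.le_one'
    | var y => exact le_of_eq (by simp [FinTerm.map, tdist])
  | app F ts ih =>
    intro u
    cases u with
    | var y => exact unitInterval.le_one'
    | app G us =>
      by_cases h : F = G
      · subst h
        rw [FinTerm.map, FinTerm.map, tdist_app, tdist_app, σ.umm_eq]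
        exact (M.isUltrametricMap F).monotone fun i => ih _ _
      · rw [tdist_app_ne h]
        exact unitInterval.le_one'

namespace Term

variable {M N : MetricSignature.{u}} {V : Type u}

/-- The translation of infinitary terms along a metric signature morphism. -/
def map (σ : M.Hom N) : Term M V → Term N V :=
  UniformSpace.Completion.map (FinTerm.map σ)

theorem map_var (σ : M.Hom N) (x : V) : map σ (var x) = var x :=
  UniformSpace.Completion.map_coe (FinTerm.lipschitz_map σ).uniformContinuous _

theorem map_app (σ : M.Hom N) (F : M.Symbol) (ts : Fin (M.arity F) → Term M V) :
    map σ (app F ts) = app (σ.toFun F) fun i => map σ (ts (Fin.cast (σ.arity_eq F) i)) := by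
  have hm : Continuous (map σ : Term M V → Term N V) := UniformSpace.Completion.continuous_map
  have := (isDenseInducing_coe_pi (M := M) (V := V) (M.arity F)).dense.equalizer
    (g := fun ts => map σ (app F ts))
    (h := fun ts => app (σ.toFun F) fun i => map σ (ts (Fin.cast (σ.arity_eq F) i)))
    (hm.comp (uniformContinuous_app F).continuous)
    ((uniformContinuous_app _).continuous.comp
      (continuous_pi fun i => hm.comp (continuous_apply _)))
    (by
      funext ts
      have h : ∀ t : FinTerm M V, map σ (t : Term M V) = (FinTerm.map σ t : FinTerm N V) :=
        UniformSpace.Completion.map_coe (FinTerm.lipschitz_map σ).uniformContinuous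
      simp only [Function.comp, app_coe, h, FinTerm.map])
  exact congrFun this ts

theorem map_eq_var {σ : M.Hom N} {t : Term M V} {x : V} (h : map σ t = var x) : t = var x := by
  rcases eq_var_or_app t with ⟨y, rfl⟩ | ⟨F, ts, rfl⟩
  · rw [map_var] at h
    rw [var_injective h]
  · rw [map_app] at h
    exact absurd h.symm (var_ne_app _ _ _)

theorem occurs_map_iff (σ : M.Hom N) (x : V) (t : Term M V) : Occurs x (map σ t) ↔ Occurs x t := by
  constructor
  · intro h
    generalize ht : map σ t = t' at h
    induction h generalizing t with
    | var =>
      rw [map_eq_var ht]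
      exact Occurs.var
    | app F ts i _ ih =>
      rcases eq_var_or_app t with ⟨y, rfl⟩ | ⟨G, us, rfl⟩
      · rw [map_var] at ht
        exact absurd ht (var_ne_app _ _ _)
      · rw [map_app] at ht
        have hFG := app_inj_symbol ht
        subst hFG
        have := congrFun (app_injective _ ht) i
        exact Occurs.app G us _ (ih _ this)
  · intro h
    induction h with
    | var =>
      rw [map_var]
      exact Occurs.var
    | app F ts i _ ih =>
      rw [map_app]
      exact Occurs.app _ _ (Fin.cast (σ.arity_eq F).symm i) ih

end Term

/-! ### Infinitary term rewriting systems -/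

/-- An infinitary term rewriting system with variables in `V`. -/
structure ITRS (V : Type u) where
  sig : MetricSignature.{u}
  rules : Set (Term sig V × Term sig V)
  lhs_ne_var : ∀ l r, (l, r) ∈ rules → ∀ x, l ≠ Term.var x
  vars_subset : ∀ l r, (l, r) ∈ rules → ∀ x, Term.Occurs x r → Term.Occurs x l

/-- The disjoint union of two signatures, keeping the ultra-metric maps of all symbols. -/
def MetricSignature.sum (M N : MetricSignature.{u}) : MetricSignature.{u} where
  Symbol := M.Symbol ⊕ N.Symbol
  arity
    | .inl F => M.arity F
    | .inr F => N.arity F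
  umm
    | .inl F => M.umm F
    | .inr F => N.umm F
  isUltrametricMap
    | .inl F => M.isUltrametricMap F
    | .inr F => N.isUltrametricMap F
  continuous_umm
    | .inl F => M.continuous_umm F
    | .inr F => N.continuous_umm F

/-- The first coproduct injection. -/
def MetricSignature.inl (M N : MetricSignature.{u}) : M.Hom (M.sum N) where
  toFun := Sum.inl
  arity_eq _ := rfl
  umm_eq _ _ := rfl

/-- The second coproduct injection. -/
def MetricSignature.inr (M N : MetricSignature.{u}) : N.Hom (M.sum N) where
  toFun := Sum.inr
  arity_eq _ := rfl
  umm_eq _ _ := rfl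

/-- The extension of a signature by a fresh unary symbol `I` (here `none`) with `I_m(x) = x`. -/
def MetricSignature.indirected (M : MetricSignature.{u}) : MetricSignature.{u} where
  Symbol := Option M.Symbol
  arity
    | none => 1
    | some F => M.arity F
  umm
    | none => fun x => x 0
    | some F => M.umm F
  isUltrametricMap
    | none => ⟨fun x => by simp [Fin.forall_fin_one], fun _ _ => rfl⟩
    | some F => M.isUltrametricMap F
  continuous_umm
    | none => continuous_apply 0
    | some F => M.continuous_umm F

/-- The inclusion of a signature into its extension by `I`. -/
def MetricSignature.toIndirected (M : MetricSignature.{u}) : M.Hom M.indirected where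
  toFun := some
  arity_eq _ := rfl
  umm_eq _ _ := rfl

/-- The term `I(t)`. -/
def Term.indir {M : MetricSignature.{u}} {V : Type u} (t : Term M.indirected V) :
    Term M.indirected V :=
  Term.app (M := M.indirected) none fun _ => t

namespace ITRS

variable {V : Type u}

/-- The single-step rewrite relation `C[θ(l)] → C[θ(r)]`. -/
def Step (R : ITRS V) (s t : Term R.sig V) : Prop :=
  ∃ (C : Context R.sig V) (θ : V → Term R.sig V) (l r : Term R.sig V),
    (l, r) ∈ R.rules ∧ s = C.fill (Term.subst θ l) ∧ t = C.fill (Term.subst θ r)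

/-- An iTRS is convergent if its rewrite relation on the metric space of infinitary terms is. -/
def Convergent (R : ITRS V) : Prop :=
  IsConvergent R.Step

/-- No rule has a variable as its right-hand side. -/
def NonCollapsing (R : ITRS V) : Prop :=
  ∀ l r, (l, r) ∈ R.rules → ∀ x, r ≠ Term.var x

/-- The disjoint union (coproduct) `R + S`. -/
def disjointUnion (R S : ITRS V) : ITRS V where
  sig := R.sig.sum S.sig
  rules :=
    Prod.map (Term.map (R.sig.inl S.sig)) (Term.map (R.sig.inl S.sig)) '' R.rules ∪
      Prod.map (Term.map (R.sig.inr S.sig)) (Term.map (R.sig.inr S.sig)) '' S.rules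
  lhs_ne_var := by
    rintro l r (⟨⟨l', r'⟩, h, he⟩ | ⟨⟨l', r'⟩, h, he⟩) x hx
    all_goals
      obtain ⟨rfl, rfl⟩ := Prod.mk.inj he
    · exact R.lhs_ne_var _ _ h x (Term.map_eq_var hx)
    · exact S.lhs_ne_var _ _ h x (Term.map_eq_var hx)
  vars_subset := by
    rintro l r (⟨⟨l', r'⟩, h, he⟩ | ⟨⟨l', r'⟩, h, he⟩) x hx
    all_goals
      obtain ⟨rfl, rfl⟩ := Prod.mk.inj he
      rw [Term.occurs_map_iff] at hx ⊢
    · exact R.vars_subset _ _ h x hx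
    · exact S.vars_subset _ _ h x hx

/-- The indirected version of an iTRS: a rule `l → I(r)` for each rule `l → r`, and the rule
`I(x) → x` (included for every name `x` of its variable). -/
def indirected (R : ITRS V) : ITRS V where
  sig := R.sig.indirected
  rules :=
    {p | ∃ l r, (l, r) ∈ R.rules ∧
      p = (Term.map R.sig.toIndirected l, Term.indir (Term.map R.sig.toIndirected r))} ∪
    {p | ∃ x : V, p = (Term.indir (Term.var x), Term.var x)}
  lhs_ne_var := by
    rintro l r (⟨l', r', h, he⟩ | ⟨y, he⟩) x hx
    all_goals
      obtain ⟨rfl, rfl⟩ := Prod.mk.inj he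
    · exact R.lhs_ne_var _ _ h x (Term.map_eq_var hx)
    · exact Term.var_ne_app _ _ _ hx.symm
  vars_subset := by
    rintro l r (⟨l', r', h, he⟩ | ⟨y, he⟩) x hx
    all_goals
      obtain ⟨rfl, rfl⟩ := Prod.mk.inj he
    · rw [Term.occurs_map_iff]
      refine R.vars_subset _ _ h x ((Term.occurs_map_iff R.sig.toIndirected x _).1 ?_)
      generalize ht : Term.indir (Term.map R.sig.toIndirected r') = t at hx
      cases hx with
      | var => exact absurd ht.symm (Term.var_ne_app _ _ _)
      | app F ts i hi =>
        have hF := Term.app_inj_symbol ht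
        subst hF
        have := congrFun (Term.app_injective _ ht) i
        rw [← this] at hi
        exact hi
    · exact Term.Occurs.app (M := R.sig.indirected) none (fun _ => Term.var y) (0 : Fin 1) hx

/-- Strong convergence: the indirected version is convergent. -/
def StronglyConvergent (R : ITRS V) : Prop :=
  R.indirected.Convergent

end ITRS

end InfRewriting

end

/-! Erasing the symbols `I` from an open reduction of the indirected sum gives a reduction of the
sum with idle steps. Idle steps do not affect convergence, so the erased sequence has a limit. The
original sequence could then fail to converge only because the number of symbols `I` at some
position keeps changing. By completeness it suffices to exclude this for the positions of a finite
term `s` that approximates the limit.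

The count of leading `I`s is controlled by the component that owns the root symbol `F`. The map
`layer` keeps the topmost part of a term built from the symbols of this component and from `I`, and
replaces every foreign subterm by a variable `x₀`. To hide all activity in foreign subterms, `I` is
made strict in `x₀`: an `I` standing on a foreign subterm is absorbed. Non-collapsingness is what
makes this work. A foreign redex is contracted to a foreign term below an `I`, so its image stays
`x₀`, while the `I` created by a native rule is never absorbed. Hence reductions of the sum project
to lazy reductions of one indirected component (`IsLayer.layer_step`). These converge, and terms at
distance less than 1 have equally many leading `I`s (`IsLayer.exists_stable`).

Once the count is stable, every step takes place inside an argument of the root symbol, since each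
contracted rule instance would create an `I` there. The arguments again form lazy reductions, and
induction on `s` applies (`exists_tdist_mem`). The tolerance is a lower set of distances, pulled
back along the ultra-metric map of the root, one coordinate at a time. -/

noncomputable section

namespace InfRewriting

/-! ### Transfinite sequences in metric spaces -/

section Sequences

variable {X Y : Type u} [PseudoMetricSpace X] [PseudoMetricSpace Y]

/-- `f` converges to `t` along the ordinals below `l`. -/
def TendsToBelow (f : Ordinal.{u} → X) (l : Ordinal.{u}) (t : X) : Prop :=
  ∀ ε > 0, ∃ b < l, ∀ β, b ≤ β → β < l → dist (f β) t < ε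

/-- The successor of `l` separates it from all larger ordinals, so the intervals `(b, l]` form a
neighbourhood basis, and the point `l` itself contributes distance 0. -/
theorem continuousAt_iff_tendsToBelow {f : Ordinal.{u} → X} {l : Ordinal.{u}}
    (hl : Order.IsSuccLimit l) : ContinuousAt f l ↔ TendsToBelow f l (f l) := by
  have h0 : ∃ a, a < l := ⟨0, hl.bot_lt⟩
  have hb := (SuccOrder.nhdsLE_eq_nhds l) ▸ nhdsLE_basis_of_exists_lt h0
  rw [ContinuousAt, hb.tendsto_iff Metric.nhds_basis_ball]
  refine forall₂_congr fun ε hε => ⟨?_, ?_⟩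
  · rintro ⟨b, hb, h⟩
    exact ⟨Order.succ b, hl.succ_lt hb, fun β h1 h2 => h β ⟨Order.succ_le_iff.1 h1, h2.le⟩⟩
  · rintro ⟨b, hb, h⟩
    refine ⟨b, hb, fun β hβ => ?_⟩
    rcases hβ.2.eq_or_lt with h2 | h2
    · rw [h2]
      exact Metric.mem_ball_self hε
    · exact h β hβ.1.le h2

/-- Ordinals that are not limits are isolated points, so continuity says something only at limits.
-/
theorem isSequence_iff {α : Ordinal.{u}} {f : Ordinal.{u} → X} :
    IsSequence α f ↔ ∀ l < α, Order.IsSuccLimit l → TendsToBelow f l (f l) := by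
  refine forall₂_congr fun l hl => ?_
  rw [continuousWithinAt_iff_continuousAt (isOpen_Iio.mem_nhds hl)]
  by_cases h : Order.IsSuccLimit l
  · simp [h, continuousAt_iff_tendsToBelow h]
  · simp only [h, false_imp_iff, iff_true, ContinuousAt, SuccOrder.nhds_eq_pure.2 h]
    exact tendsto_pure_nhds f l

theorem IsSequence.map {α : Ordinal.{u}} {f : Ordinal.{u} → X} (h : IsSequence α f) {φ : X → Y}
    (hφ : Continuous φ) : IsSequence α fun β => φ (f β) :=
  hφ.comp_continuousOn h

theorem sequenceConverges_iff {α : Ordinal.{u}} (hα : Order.IsSuccLimit α)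
    {f : Ordinal.{u} → X} (hf : IsSequence α f) :
    SequenceConverges α f ↔ ∃ t, TendsToBelow f α t := by
  constructor
  · rintro ⟨g, hg, hgf⟩
    refine ⟨g α, fun ε hε => ?_⟩
    obtain ⟨b, hb, h⟩ := isSequence_iff.1 hg α (Order.lt_add_one_iff.2 le_rfl) hα ε hε
    exact ⟨b, hb, fun β h1 h2 => hgf β h2 ▸ h β h1 h2⟩
  · rintro ⟨t, ht⟩
    have hne : ∀ β < α, Function.update f α t β = f β := fun β hβ =>
      Function.update_of_ne hβ.ne _ _
    refine ⟨Function.update f α t, isSequence_iff.2 fun l hl hl' ε hε => ?_, hne⟩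
    rcases (Order.lt_add_one_iff.1 hl).eq_or_lt with rfl | hlt
    · obtain ⟨b, hb, h⟩ := ht ε hε
      refine ⟨b, hb, fun β h1 h2 => ?_⟩
      rw [hne β h2, Function.update_self]
      exact h β h1 h2
    · obtain ⟨b, hb, h⟩ := isSequence_iff.1 hf l hlt hl' ε hε
      refine ⟨b, hb, fun β h1 h2 => ?_⟩
      rw [hne β (h2.trans hlt), hne l hlt]
      exact h β h1 h2

/-- A Cauchy sequence in a complete space converges. -/
theorem exists_tendsToBelow [CompleteSpace X] {α : Ordinal.{u}} (hα : Order.IsSuccLimit α)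
    {f : Ordinal.{u} → X}
    (h : ∀ ε > 0, ∃ b < α, ∀ β γ, b ≤ β → β < α → b ≤ γ → γ < α → dist (f β) (f γ) < ε) :
    ∃ t, TendsToBelow f α t := by
  have h0 : ∃ a, a < α := ⟨0, hα.bot_lt⟩
  have hb := nhdsLT_basis_of_exists_lt h0
  have : (𝓝[<] α).NeBot := hb.neBot_iff.2 fun {b} hb' =>
    ⟨Order.succ b, Order.lt_succ b, hα.succ_lt hb'⟩
  have hc : Cauchy (map f (𝓝[<] α)) := by
    rw [Metric.cauchy_iff]
    refine ⟨inferInstance, fun ε hε => ?_⟩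
    obtain ⟨b, hbα, H⟩ := h ε hε
    refine ⟨f '' Set.Ioo b α, image_mem_map (hb.mem_of_mem hbα), ?_⟩
    rintro _ ⟨β, hβ, rfl⟩ _ ⟨γ, hγ, rfl⟩
    exact H β γ hβ.1.le hβ.2 hγ.1.le hγ.2
  obtain ⟨t, ht⟩ := CompleteSpace.complete hc
  refine ⟨t, fun ε hε => ?_⟩
  obtain ⟨b, hb1, hb2⟩ := (hb.tendsto_iff Metric.nhds_basis_ball).1 ht ε hε
  exact ⟨Order.succ b, hα.succ_lt hb1, fun β h1 h2 => hb2 β ⟨Order.succ_le_iff.1 h1, h2⟩⟩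

end Sequences

/-! ### Reduction sequences with stuttering -/

section Stuttering

variable {X : Type u} [MetricSpace X]

/-- Transfinite induction on `c`: idle steps handle successors, and continuity carries the constant
value across limits. -/
theorem eq_of_forall_eq_succ {α : Ordinal.{u}} {f : Ordinal.{u} → X} (hf : IsSequence α f)
    {b : Ordinal.{u}} : ∀ c < α, b ≤ c → (∀ γ, b ≤ γ → γ < c → f γ = f (γ + 1)) → f b = f c := by
  intro c
  induction c using Ordinal.limitRecOn with
  | zero =>
    intro _ hb _
    rw [le_antisymm hb zero_le]
  | add_one c ih =>
    intro hc hb h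
    rcases hb.eq_or_lt with rfl | hlt
    · rfl
    · have hbc : b ≤ c := Order.lt_add_one_iff.1 hlt
      have hcc : c < c + 1 := Order.lt_add_one_iff.2 le_rfl
      rw [ih (hcc.trans hc) hbc fun γ h1 h2 => h γ h1 (h2.trans hcc), h c hbc hcc]
  | limit c hlim ih =>
    intro hc hb h
    rcases hb.eq_or_lt with rfl | hlt
    · rfl
    · refine dist_le_zero.1 (le_of_forall_gt_imp_ge_of_dense fun ε hε => ?_)
      obtain ⟨d, hd, H⟩ := isSequence_iff.1 hf c hc hlim ε hε
      have hm : max b d < c := max_lt hlt hd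
      rw [ih _ hm (hm.trans hc) (le_max_left _ _) fun γ h1 h2 => h γ h1 (h2.trans hm)]
      exact (H _ (le_max_right _ _) hm).le

/-- Allowing idle steps does not destroy convergence. -/
theorem IsConvergent.stutter {r : X → X → Prop} (hr : IsConvergent r) :
    IsConvergent fun s t => s = t ∨ r s t := by
  intro α f hα hf
  rw [sequenceConverges_iff hα hf.isSequence]
  -- The positions of genuine steps, together with all ordinals from `α` on. The latter make the set
  -- unbounded, so that `Ordinal.enumOrd` applies, and they put `α` itself into its range, at an
  -- index `l` which becomes the length of the sequence without idle steps.
  set A : Set Ordinal.{u} := {β | β < α → f β ≠ f (β + 1)} with hA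
  have hsucc : ∀ {β}, β < α → β + 1 < α := fun h => hα.add_one_lt h
  have hconst : ∀ b c, b ≤ c → c < α → (∀ γ, b ≤ γ → γ < c → γ ∉ A) → f b = f c := by
    refine fun b c hbc hc h => eq_of_forall_eq_succ hf.isSequence c hc hbc fun γ h1 h2 => ?_
    by_contra hne
    exact h γ h1 h2 fun _ => hne
  by_cases hcof : ∃ b < α, ∀ γ, b ≤ γ → γ < α → γ ∉ A
  · obtain ⟨b, hb, h⟩ := hcof
    refine ⟨f b, fun ε hε => ⟨b, hb, fun β h1 h2 => ?_⟩⟩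
    rw [hconst b β h1 h2 fun γ h3 h4 => h γ h3 (h4.trans h2), dist_self]
    exact hε
  push Not at hcof
  have hAα : ∀ β, α ≤ β → β ∈ A := fun β h h' => absurd h' h.not_gt
  have hunb : ¬ BddAbove A := by
    rintro ⟨b, hb⟩
    exact (Order.lt_succ (max b α)).not_ge ((hb (hAα _ ((le_max_right b α).trans
      (Order.le_succ _)))).trans (le_max_left b α))
  set e := Ordinal.enumOrd A
  have he : StrictMono e := Ordinal.enumOrd_strictMono hunb
  have heA : ∀ i, e i ∈ A := Ordinal.enumOrd_mem hunb
  obtain ⟨l, hl⟩ : ∃ l, e l = α := Ordinal.enumOrd_surjective hunb (hAα α le_rfl)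
  have hlt : ∀ i < l, e i < α := fun i hi => hl ▸ he hi
  have hcof' : ∀ b < α, ∃ i < l, b ≤ e i := by
    intro b hb
    obtain ⟨γ, h1, h2, h3⟩ := hcof b hb
    obtain ⟨i, rfl⟩ := Ordinal.enumOrd_surjective hunb h3
    exact ⟨i, he.lt_iff_lt.1 (hl ▸ h2), h1⟩
  have hlim : Order.IsSuccLimit l := by
    refine Order.isSuccLimit_iff_of_orderBot.2 ⟨?_, Order.isSuccPrelimit_of_succ_lt fun i hi => ?_⟩
    · rintro rfl
      obtain ⟨i, hi, -⟩ := hcof' 0 hα.bot_lt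
      exact not_lt_bot hi
    · obtain ⟨j, hj, h⟩ := hcof' _ (hsucc (hlt i hi))
      exact (Order.succ_le_of_lt (he.lt_iff_lt.1 (Order.add_one_le_iff.1 h))).trans_lt hj
  have hgap : ∀ i γ, (∀ j < i, e j < γ) → γ < e i → γ ∉ A := by
    intro i γ h1 h2 h3
    exact (Ordinal.enumOrd_le_of_forall_lt h3 h1).not_gt h2
  have hg : IsReductionSequence r l fun i => f (e i) := by
    refine ⟨isSequence_iff.2 fun i hi hi' => ?_, fun i hi => ?_⟩
    -- The enumeration need not be continuous: the supremum `m` of the earlier positions may lie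
    -- strictly below `e i`. Only idle steps lie in between, so continuity of `f` at `m` is enough.
    · obtain ⟨m, hm, hmin⟩ : ∃ m, (∀ j < i, e j < m) ∧ ∀ m' < m, ∃ j < i, m' ≤ e j := by
        have hne : {m | ∀ j < i, e j < m}.Nonempty := ⟨e i, fun j hj => he hj⟩
        refine ⟨sInf {m | ∀ j < i, e j < m}, csInf_mem hne, fun m' hm' => ?_⟩
        by_contra! h
        exact hm'.not_ge (csInf_le' h)
      have hmi : m ≤ e i := by
        by_contra! h
        obtain ⟨j, hj, h⟩ := hmin _ h
        exact h.not_gt (he hj)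
      have hmlim : Order.IsSuccLimit m := by
        refine Order.isSuccLimit_iff_of_orderBot.2
          ⟨?_, Order.isSuccPrelimit_of_succ_lt fun b hb => ?_⟩
        · rintro rfl
          exact not_lt_bot (hm 0 hi'.bot_lt)
        · obtain ⟨j, hj, h⟩ := hmin b hb
          exact (Order.succ_le_of_lt (h.trans_lt (he (Order.lt_succ j)))).trans_lt
            (hm _ (hi'.succ_lt hj))
      intro ε hε
      have hmα : m < α := hmi.trans_lt (hlt i hi)
      obtain ⟨b, hb, H⟩ := isSequence_iff.1 hf.isSequence m hmα hmlim ε hε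
      obtain ⟨j, hj, hbj⟩ := hmin b hb
      refine ⟨j, hj, fun k h1 h2 => ?_⟩
      rw [← hconst m (e i) hmi (hlt i hi) fun γ h3 h4 =>
        hgap i γ (fun j hj => (hm j hj).trans_le h3) h4]
      exact H _ (hbj.trans (he.monotone h1)) (hm k h2)
    · have h1 : i < i + 1 := Order.lt_add_one_iff.2 le_rfl
      have h2 := hlt _ (h1.trans hi)
      have h3 : e i + 1 ≤ e (i + 1) := Order.add_one_le_of_lt (he h1)
      have h4 : f (e i + 1) = f (e (i + 1)) := hconst _ _ h3 (hlt _ hi) fun γ h5 h6 =>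
        hgap (i + 1) γ (fun j hj => (he.monotone (Order.lt_add_one_iff.1 hj)).trans_lt
          (Order.add_one_le_iff.1 h5)) h6
      rw [← h4]
      exact (hf.step _ (hsucc h2)).resolve_left (heA i h2)
  obtain ⟨t, ht⟩ := (sequenceConverges_iff hlim hg.isSequence).1 (hr l _ hlim hg)
  refine ⟨t, fun ε hε => ?_⟩
  obtain ⟨i, hi, H⟩ := ht ε hε
  refine ⟨e i, hlt i hi, fun β h1 h2 => ?_⟩
  -- The first genuine step at or after `β`; `f` is constant from `β` up to it.
  obtain ⟨j, hj, hmin⟩ : ∃ j, β ≤ e j ∧ ∀ k < j, e k < β := by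
    obtain ⟨j, hj⟩ : {j | β ≤ e j}.Nonempty := ⟨β, he.le_apply⟩
    refine ⟨sInf {j | β ≤ e j}, csInf_mem ⟨j, hj⟩, fun k hk => ?_⟩
    by_contra! h
    exact hk.not_ge (csInf_le' h)
  have hjl : j < l := by
    obtain ⟨k, hk, h⟩ := hcof' β h2
    by_contra! h'
    exact (hmin k (hk.trans_le h')).not_ge h
  rw [hconst β (e j) hj (hlt j hjl) fun γ h3 h4 =>
    hgap j γ (fun k hk => (hmin k hk).trans_le h3) h4]
  exact H j (he.le_iff_le.1 (h1.trans hj)) hjl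

/-- A tail of a reduction sequence, padded with idle steps. -/
theorem IsReductionSequence.tail {r : X → X → Prop} {α : Ordinal.{u}} {f : Ordinal.{u} → X}
    (hf : IsReductionSequence (fun s t => s = t ∨ r s t) α f) {b : Ordinal.{u}} (hb : b < α) :
    IsReductionSequence (fun s t => s = t ∨ r s t) α fun β => f (max β b) := by
  refine ⟨ContinuousOn.comp hf.isSequence (by fun_prop) fun β hβ => max_lt hβ hb, fun β hβ => ?_⟩
  rcases lt_or_ge β b with h | h
  · left
    rw [max_eq_right h.le, max_eq_right (Order.add_one_le_of_lt h)]
  · rw [max_eq_left h, max_eq_left (h.trans (Order.lt_add_one_iff.2 le_rfl).le)]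
    exact hf.step β hβ

end Stuttering

/-! ### Structural recursion and induction on infinitary terms -/

section Fold

variable {M N : MetricSignature.{u}} {V : Type u}

theorem Term.continuous_app (F : M.Symbol) :
    Continuous (app F : (Fin (M.arity F) → Term M V) → Term M V) :=
  (uniformContinuous_app F).continuous

/-- Structural induction on infinitary terms, for closed predicates. -/
theorem Term.induction_of_isClosed {P : Term M V → Prop} (hP : IsClosed {t | P t})
    (hvar : ∀ x, P (var x)) (happ : ∀ F ts, (∀ i, P (ts i)) → P (app F ts)) (t : Term M V) :
    P t := by
  induction t using UniformSpace.Completion.induction_on with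
  | hp => exact hP
  | ih t =>
    induction t with
    | var x => exact hvar x
    | app F ts ih =>
      rw [← app_coe]
      exact happ F _ ih

/-- The interpretation of finite terms given by operations `op` and values `ν` of the variables. -/
def FinTerm.fold (op : ∀ G : N.Symbol, (Fin (N.arity G) → Term M V) → Term M V)
    (ν : V → Term M V) : FinTerm N V → Term M V
  | .var x => ν x
  | .app G ts => op G fun i => FinTerm.fold op ν (ts i)

/-- The continuous extension of `FinTerm.fold` to infinitary terms. -/
def Term.fold (op : ∀ G : N.Symbol, (Fin (N.arity G) → Term M V) → Term M V)
    (ν : V → Term M V) : Term N V → Term M V :=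
  UniformSpace.Completion.extension (FinTerm.fold op ν)

namespace Term

variable {op : ∀ G : N.Symbol, (Fin (N.arity G) → Term M V) → Term M V} {ν : V → Term M V}

/-- The operations do not increase distances more than the ultra-metric maps of their symbols. -/
def IsNonexpansive (op : ∀ G : N.Symbol, (Fin (N.arity G) → Term M V) → Term M V) : Prop :=
  ∀ G ts us, tdist (op G ts) (op G us) ≤ N.umm G fun i => tdist (ts i) (us i)

theorem IsNonexpansive.continuous (hop : IsNonexpansive op) (G : N.Symbol) :
    Continuous (op G) := by
  refine Metric.continuous_iff.2 fun us ε hε => ?_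
  obtain ⟨δ, hδ, h⟩ := FinTerm.umm_small G hε
  refine ⟨δ, hδ, fun ts hts => lt_of_le_of_lt (hop G ts us) (h _ fun i => ?_)⟩
  exact (dist_pi_lt_iff hδ).1 hts i

/-- Terms with different roots already have the maximal distance 1, so only equal roots require the
hypothesis on the operations. -/
theorem tdist_finFold_le (hop : IsNonexpansive op) : ∀ t u : FinTerm N V,
    tdist (t.fold op ν) (u.fold op ν) ≤ FinTerm.tdist t u := by
  intro t
  induction t with
  | var x =>
    intro u
    cases u with
    | app G us => exact unitInterval.le_one'
    | var y =>
      by_cases h : x = y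
      · subst h
        rw [FinTerm.tdist_self]
        exact le_of_eq (Subtype.ext (dist_self _))
      · simp only [FinTerm.tdist, if_neg h]
        exact unitInterval.le_one'
  | app F ts ih =>
    intro u
    cases u with
    | var y => exact unitInterval.le_one'
    | app G us =>
      by_cases h : F = G
      · subst h
        rw [FinTerm.tdist_app]
        exact (hop F _ _).trans ((N.isUltrametricMap F).monotone fun i => ih i _)
      · rw [FinTerm.tdist_app_ne h]
        exact unitInterval.le_one'

theorem uniformContinuous_finFold (hop : IsNonexpansive op) :
    UniformContinuous (FinTerm.fold op ν) :=
  (LipschitzWith.of_dist_le_mul (K := 1) fun t u => by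
    rw [NNReal.coe_one, one_mul]
    exact tdist_finFold_le hop t u).uniformContinuous

theorem continuous_fold : Continuous (fold op ν) :=
  UniformSpace.Completion.continuous_extension

theorem fold_coe (hop : IsNonexpansive op) (t : FinTerm N V) :
    fold op ν (t : Term N V) = t.fold op ν :=
  UniformSpace.Completion.extension_coe (uniformContinuous_finFold hop) t

theorem fold_var (hop : IsNonexpansive op) (x : V) : fold op ν (var x) = ν x :=
  fold_coe hop _

theorem fold_app (hop : IsNonexpansive op) (G : N.Symbol) (ts : Fin (N.arity G) → Term N V) :
    fold op ν (app G ts) = op G fun i => fold op ν (ts i) := by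
  have := (isDenseInducing_coe_pi (M := N) (V := V) (N.arity G)).dense.equalizer
    (g := fun ts => fold op ν (app G ts)) (h := fun ts => op G fun i => fold op ν (ts i))
    (continuous_fold.comp (continuous_app G))
    ((hop.continuous G).comp (continuous_pi fun i => continuous_fold.comp (continuous_apply i)))
    (by
      funext ts
      simp only [Function.comp, app_coe, fold_coe hop, FinTerm.fold])
  exact congrFun this ts

theorem isNonexpansive_app :
    IsNonexpansive (app : ∀ F : M.Symbol, (Fin (M.arity F) → Term M V) → Term M V) :=
  fun F ts us => (tdist_app F ts us).le

theorem subst_eq_fold (θ : V → Term M V) : subst θ = fold app θ := by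
  have : (FinTerm.eval θ : FinTerm M V → Term M V) = FinTerm.fold app θ := by
    funext t
    induction t with
    | var x => rfl
    | app F ts ih => simp only [FinTerm.eval, FinTerm.fold, ih]
  rw [subst, fold, this]

theorem continuous_subst (θ : V → Term M V) : Continuous (subst θ) :=
  subst_eq_fold θ ▸ continuous_fold

theorem subst_var (θ : V → Term M V) (x : V) : subst θ (var x) = θ x := by
  rw [subst_eq_fold, fold_var isNonexpansive_app]

theorem subst_app (θ : V → Term M V) (F : M.Symbol) (ts : Fin (M.arity F) → Term M V) :
    subst θ (app F ts) = app F fun i => subst θ (ts i) := by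
  rw [subst_eq_fold, fold_app isNonexpansive_app]

theorem continuous_map (σ : M.Hom N) : Continuous (map σ : Term M V → Term N V) :=
  UniformSpace.Completion.continuous_map

theorem tdist_self (t : Term M V) : tdist t t = 0 := Subtype.ext (dist_self t)

theorem tdist_app_ne {F G : M.Symbol} (h : F ≠ G) (ts : Fin (M.arity F) → Term M V)
    (us : Fin (M.arity G) → Term M V) : tdist (app F ts) (app G us) = 1 :=
  Subtype.ext (dist_app_ne h ts us)

theorem tdist_var_app (x : V) (F : M.Symbol) (ts : Fin (M.arity F) → Term M V) :
    tdist (var x) (app F ts) = 1 :=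
  Subtype.ext (dist_var_app x F ts)

theorem tdist_var_of_ne {x : V} {t : Term M V} (h : t ≠ var x) : tdist (var x) t = 1 := by
  rcases eq_var_or_app t with ⟨y, rfl⟩ | ⟨F, ts, rfl⟩
  · have hxy : x ≠ y := fun e => h (e ▸ rfl)
    rw [var, var, tdist_coe, FinTerm.tdist, if_neg hxy]
  · exact tdist_var_app x F ts

theorem tdist_comm (t u : Term M V) : tdist t u = tdist u t :=
  Subtype.ext (dist_comm t u)

/-- An ultra-metric map is positive when one coordinate is positive. The minimum of these values
over the finitely many coordinates bounds the distance of two values from below as soon as some pair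
of arguments is far apart. This makes the arguments depend continuously on the term. -/
theorem isUniformInducing_app (F : M.Symbol) :
    IsUniformInducing (app F : (Fin (M.arity F) → Term M V) → Term M V) := by
  have hu := M.isUltrametricMap F
  rw [Metric.isUniformInducing_iff]
  refine ⟨uniformContinuous_app F, fun δ hδ => ?_⟩
  let e : unitInterval := ⟨min δ 1, (lt_min hδ one_pos).le, min_le_right _ _⟩
  let x : Fin (M.arity F) → (Fin (M.arity F) → unitInterval) := fun i => Pi.single i e
  have hx : ∀ i, 0 < M.umm F (x i) := fun i => by
    refine unitInterval.pos_iff_ne_zero.2 fun h => ?_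
    have := (hu.eq_zero_iff _).1 h i
    simp only [x, Pi.single_eq_same] at this
    exact (lt_min hδ one_pos).ne' (congrArg Subtype.val this)
  obtain ⟨ε, hε, hle⟩ : ∃ ε : ℝ, 0 < ε ∧ ∀ i, ε ≤ (M.umm F (x i) : ℝ) := by
    rcases isEmpty_or_nonempty (Fin (M.arity F)) with hE | hE
    · exact ⟨1, one_pos, fun i => hE.elim i⟩
    · obtain ⟨i, hi⟩ := Finite.exists_min fun i => (M.umm F (x i) : ℝ)
      exact ⟨_, hx i, hi⟩
  refine ⟨ε, hε, fun {ts us} h => (dist_pi_lt_iff hδ).2 fun i => ?_⟩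
  by_contra! hge
  have h1 : M.umm F (x i) ≤ tdist (app F ts) (app F us) := by
    rw [tdist_app]
    refine hu.monotone fun j => ?_
    by_cases hj : j = i
    · subst hj
      simp only [x, Pi.single_eq_same]
      exact show min δ 1 ≤ dist (ts j) (us j) from (min_le_left δ 1).trans hge
    · simp only [x, Pi.single_eq_of_ne hj]
      exact unitInterval.nonneg'
  exact absurd h (not_lt.2 ((hle i).trans h1))

end Term

/-- As `f` preserves maxima in a linear order, its value is attained by one of the coordinates
alone, or is `f 0 = 0`. This permits treating the arguments of a symbol separately. -/
theorem IsUltrametricMap.mem_of_single {n : ℕ} {f : (Fin n → unitInterval) → unitInterval}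
    (hf : IsUltrametricMap f) {L : Set unitInterval} (h0 : 0 ∈ L)
    (x : Fin n → unitInterval) (h : ∀ i, f (Pi.single i (x i)) ∈ L) : f x ∈ L := by
  have key : ∀ s : Finset (Fin n), f (fun i => if i ∈ s then x i else 0) ∈ L := by
    intro s
    induction s using Finset.induction_on with
    | empty => simpa [(hf.eq_zero_iff fun _ => 0).2 fun _ => rfl] using h0
    | insert a s ha ih =>
      have : (fun i => if i ∈ insert a s then x i else 0)
          = Pi.single a (x a) ⊔ fun i => if i ∈ s then x i else 0 := by
        funext i
        by_cases hi : i = a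
        · subst hi
          simp [ha]
        · simp [hi]
      rw [this, hf.map_sup]
      rcases le_total (f (Pi.single a (x a))) (f fun i => if i ∈ s then x i else 0) with h1 | h1
      · rwa [sup_eq_right.2 h1]
      · rw [sup_eq_left.2 h1]
        exact h a
  simpa using key Finset.univ

end Fold

/-! ### Rewrite steps -/

namespace ITRS

variable {V : Type u} {R : ITRS V}

theorem Step.root {l r : Term R.sig V} (h : (l, r) ∈ R.rules) (θ : V → Term R.sig V) :
    R.Step (Term.subst θ l) (Term.subst θ r) :=
  ⟨.hole, θ, l, r, h, rfl, rfl⟩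

theorem Step.app (F : R.sig.Symbol) (ts us : Fin (R.sig.arity F) → Term R.sig V)
    (i : Fin (R.sig.arity F)) (h : R.Step (ts i) (us i)) (hne : ∀ j ≠ i, ts j = us j) :
    R.Step (Term.app F ts) (Term.app F us) := by
  obtain ⟨C, θ, l, r, hlr, hs, ht⟩ := h
  refine ⟨.app F i ts C, θ, l, r, hlr, ?_, ?_⟩
  · rw [Context.fill, ← hs, Function.update_eq_self]
  · rw [Context.fill, ← ht]
    congr 1
    funext j
    by_cases hj : j = i
    · subst hj
      simp
    · rw [Function.update_of_ne hj, hne j hj]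

theorem Step.rec_on {P : Term R.sig V → Term R.sig V → Prop}
    (root : ∀ l r, (l, r) ∈ R.rules → ∀ θ, P (Term.subst θ l) (Term.subst θ r))
    (app : ∀ F ts us i, R.Step (ts i) (us i) → P (ts i) (us i) → (∀ j ≠ i, ts j = us j) →
      P (Term.app F ts) (Term.app F us))
    {s t : Term R.sig V} (h : R.Step s t) : P s t := by
  obtain ⟨C, θ, l, r, hlr, rfl, rfl⟩ := h
  induction C with
  | hole => exact root l r hlr θ
  | app F i ts C ih =>
    refine app F _ _ i ?_ ?_ fun j hj => ?_
    · simp only [Function.update_self]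
      exact ⟨C, θ, l, r, hlr, rfl, rfl⟩
    · simpa only [Function.update_self] using ih
    · rw [Function.update_of_ne hj, Function.update_of_ne hj]

theorem exists_lhs_eq_app {l r : Term R.sig V} (h : (l, r) ∈ R.rules) :
    ∃ F ts, l = Term.app F ts :=
  (Term.eq_var_or_app l).resolve_left fun ⟨x, hx⟩ => R.lhs_ne_var l r h x hx

theorem NonCollapsing.exists_rhs_eq_app (hR : R.NonCollapsing) {l r : Term R.sig V}
    (h : (l, r) ∈ R.rules) : ∃ F ts, r = Term.app F ts :=
  (Term.eq_var_or_app r).resolve_left fun ⟨x, hx⟩ => hR l r h x hx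

end ITRS

/-! ### Terms over an indirected signature -/

section Indirected

variable {M N : MetricSignature.{u}} {V : Type u}

namespace Term

theorem app_none (ts : Fin (M.indirected.arity none) → Term M.indirected V) :
    app (M := M.indirected) none ts = indir (ts (0 : Fin 1)) := by
  rw [indir]
  congr 1
  funext i
  rw [Subsingleton.elim (α := Fin 1) i 0]

theorem indir_injective : Function.Injective (indir : Term M.indirected V → _) := fun _ _ h =>
  congrFun (app_injective (M := M.indirected) none h) (0 : Fin 1)

theorem tdist_indir (t u : Term M.indirected V) : tdist (indir t) (indir u) = tdist t u :=
  tdist_app (M := M.indirected) none _ _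

/-- The term-forming operation of a symbol other than `I`. -/
def inApp (F : M.Symbol) (ts : Fin (M.arity F) → Term M.indirected V) : Term M.indirected V :=
  app (M := M.indirected) (some F) ts

theorem indir_ne_inApp (t : Term M.indirected V) (F : M.Symbol)
    (ts : Fin (M.arity F) → Term M.indirected V) : indir t ≠ inApp F ts := fun h =>
  Option.some_ne_none F (app_inj_symbol h).symm

theorem inApp_ne_indir (F : M.Symbol) (ts : Fin (M.arity F) → Term M.indirected V)
    (t : Term M.indirected V) : inApp F ts ≠ indir t :=
  (indir_ne_inApp t F ts).symm

theorem indir_ne_var (t : Term M.indirected V) (x : V) : indir t ≠ var x :=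
  (var_ne_app _ _ _).symm

theorem inApp_ne_var (F : M.Symbol) (ts : Fin (M.arity F) → Term M.indirected V) (x : V) :
    inApp F ts ≠ var x :=
  (var_ne_app _ _ _).symm

theorem inApp_injective (F : M.Symbol) :
    Function.Injective (inApp F : (Fin (M.arity F) → Term M.indirected V) → _) :=
  app_injective (M := M.indirected) (some F)

theorem inApp_inj_symbol {F G : M.Symbol} {ts : Fin (M.arity F) → Term M.indirected V}
    {us : Fin (M.arity G) → Term M.indirected V} (h : inApp F ts = inApp G us) : F = G :=
  Option.some_injective _ (app_inj_symbol h)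

theorem tdist_inApp (F : M.Symbol) (ts us : Fin (M.arity F) → Term M.indirected V) :
    tdist (inApp F ts) (inApp F us) = M.umm F fun i => tdist (ts i) (us i) :=
  tdist_app (M := M.indirected) (some F) ts us

theorem isInducing_indir : IsInducing (indir : Term M.indirected V → _) :=
  (Isometry.of_dist_eq fun t u => congrArg Subtype.val (tdist_indir t u)).isEmbedding.isInducing

theorem isInducing_inApp (F : M.Symbol) :
    IsInducing (inApp F : (Fin (M.arity F) → Term M.indirected V) → _) :=
  (isUniformInducing_app (M := M.indirected) (some F)).isInducing

theorem var_or_indir_or_inApp (t : Term M.indirected V) :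
    (∃ x, t = var x) ∨ (∃ u, t = indir u) ∨ ∃ F ts, t = inApp F ts := by
  rcases eq_var_or_app t with ⟨x, rfl⟩ | ⟨_ | F, ts, rfl⟩
  · exact Or.inl ⟨x, rfl⟩
  · exact Or.inr (Or.inl ⟨_, app_none ts⟩)
  · exact Or.inr (Or.inr ⟨F, ts, rfl⟩)

theorem subst_indir (θ : V → Term M.indirected V) (t : Term M.indirected V) :
    subst θ (indir t) = indir (subst θ t) :=
  subst_app θ (none : M.indirected.Symbol) _

theorem subst_inApp (θ : V → Term M.indirected V) (F : M.Symbol)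
    (ts : Fin (M.arity F) → Term M.indirected V) :
    subst θ (inApp F ts) = inApp F fun i => subst θ (ts i) :=
  subst_app θ (some F : M.indirected.Symbol) _

theorem map_toIndirected_app (F : M.Symbol) (ts : Fin (M.arity F) → Term M V) :
    map M.toIndirected (app F ts) = inApp F fun i => map M.toIndirected (ts i) :=
  map_app M.toIndirected F ts

theorem tdist_indir_of_forall_ne {u : Term M.indirected V} (hu : ∀ v, u ≠ indir v)
    (t : Term M.indirected V) : tdist (indir t) u = 1 := by
  rcases var_or_indir_or_inApp u with ⟨x, rfl⟩ | ⟨v, rfl⟩ | ⟨F, ts, rfl⟩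
  · exact (tdist_comm _ _).trans (tdist_var_app x _ _)
  · exact absurd rfl (hu v)
  · exact tdist_app_ne (M := M.indirected) (Option.some_ne_none F).symm _ _

/-- Distance below 1 forces equal root symbols, and `I` is isometric, so symbols `I` can be removed
in pairs. -/
theorem iterate_indir_eq_of_tdist_lt {t u : Term M.indirected V} (ht : ∀ v, t ≠ indir v)
    (hu : ∀ v, u ≠ indir v) : ∀ n m : ℕ, tdist (indir^[n] t) (indir^[m] u) < 1 → n = m
  | 0, 0, _ => rfl
  | n + 1, 0, h => by
    rw [Function.iterate_succ_apply', Function.iterate_zero, id, tdist_indir_of_forall_ne hu] at h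
    exact absurd h (lt_irrefl _)
  | 0, m + 1, h => by
    rw [Function.iterate_succ_apply', Function.iterate_zero, id, tdist_comm,
      tdist_indir_of_forall_ne ht] at h
    exact absurd h (lt_irrefl _)
  | n + 1, m + 1, h => by
    rw [Function.iterate_succ_apply', Function.iterate_succ_apply', tdist_indir] at h
    rw [iterate_indir_eq_of_tdist_lt ht hu n m h]

theorem tdist_iterate_indir (t u : Term M.indirected V) (n : ℕ) :
    tdist (indir^[n] t) (indir^[n] u) = tdist t u := by
  induction n with
  | zero => rfl
  | succ n ih => rw [Function.iterate_succ_apply', Function.iterate_succ_apply', tdist_indir, ih]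

/-- Every infinitary term has only finitely many symbols `I` above the topmost other symbol. -/
theorem exists_eq_iterate_indir (t : Term M.indirected V) : ∃ n u, t = indir^[n] u ∧
    ((∃ x, u = var x) ∨ ∃ F ts, u = inApp F ts) := by
  -- At distance below 1 the root of `t` agrees with that of a finite term, and removing an `I` from
  -- both preserves the distance; induction on the finite term bounds the number of `I`s.
  obtain ⟨s, hs⟩ := UniformSpace.Completion.denseRange_coe.exists_dist_lt t one_pos
  replace hs : tdist t (s : Term M.indirected V) < 1 := hs
  induction s generalizing t with
  | var x =>
    refine ⟨0, t, rfl, Or.inl ⟨x, ?_⟩⟩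
    by_contra h
    have := tdist_var_of_ne h
    rw [tdist_comm] at this
    exact hs.ne this
  | app G ss ih =>
    rw [← app_coe] at hs
    rcases eq_var_or_app t with ⟨x, rfl⟩ | ⟨G', ts, rfl⟩
    · exact absurd (tdist_var_app x _ _) hs.ne
    · by_cases h : G' = G
      · subst h
        cases G' with
        | some F => exact ⟨0, _, rfl, Or.inr ⟨F, ts, rfl⟩⟩
        | none =>
          obtain ⟨n, u, h1, h2⟩ := ih (0 : Fin 1) (ts (0 : Fin 1))
            ((tdist_app (M := M.indirected) none _ _).symm.trans_lt hs)
          refine ⟨n + 1, u, ?_, h2⟩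
          rw [app_none, h1, Function.iterate_succ_apply']
      · exact absurd (tdist_app_ne h _ _) hs.ne

/-! #### Erasing indirections -/

/-- The operations that interpret `I` as the identity. -/
def eraseOp : ∀ G : M.indirected.Symbol, (Fin (M.indirected.arity G) → Term M V) → Term M V
  | none => fun ts => ts (0 : Fin 1)
  | some F => fun ts => app F ts

theorem isNonexpansive_eraseOp : IsNonexpansive (eraseOp (M := M) (V := V))
  | none, _, _ => le_rfl
  | some F, ts, us => (tdist_app F ts us).le

/-- Removal of all symbols `I`. -/
def erase : Term M.indirected V → Term M V := fold eraseOp var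

theorem continuous_erase : Continuous (erase : Term M.indirected V → Term M V) := continuous_fold

theorem erase_var (x : V) : erase (var x : Term M.indirected V) = var x :=
  fold_var isNonexpansive_eraseOp x

theorem erase_indir (t : Term M.indirected V) : erase (indir t) = erase t :=
  fold_app isNonexpansive_eraseOp none _

theorem erase_inApp (F : M.Symbol) (ts : Fin (M.arity F) → Term M.indirected V) :
    erase (inApp F ts) = app F fun i => erase (ts i) :=
  fold_app isNonexpansive_eraseOp (some F) _

theorem erase_iterate_indir (n : ℕ) (t : Term M.indirected V) :
    erase (indir^[n] t) = erase t := by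
  induction n with
  | zero => rfl
  | succ n ih => rw [Function.iterate_succ_apply', erase_indir, ih]

theorem erase_subst_map (θ : V → Term M.indirected V) (t : Term M V) :
    erase (subst θ (map M.toIndirected t)) = subst (fun x => erase (θ x)) t := by
  induction t using induction_of_isClosed with
  | hP =>
    exact isClosed_eq (continuous_erase.comp ((continuous_subst _).comp (continuous_map _)))
      (continuous_subst _)
  | hvar x => rw [map_var, subst_var, subst_var]
  | happ F ts ih => simp only [map_toIndirected_app, subst_inApp, subst_app, erase_inApp, ih]

/-! #### The top layer of a term -/

open Classical in
/-- The symbol `I` as an operation that is strict in the variable `x₀`. -/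
def strictIndir (x₀ : V) (t : Term M.indirected V) : Term M.indirected V :=
  if t = var x₀ then var x₀ else indir t

theorem strictIndir_var (x₀ : V) : strictIndir x₀ (var x₀ : Term M.indirected V) = var x₀ :=
  if_pos rfl

theorem strictIndir_of_ne {x₀ : V} {t : Term M.indirected V} (h : t ≠ var x₀) :
    strictIndir x₀ t = indir t :=
  if_neg h

/-- The case distinction does no harm because a variable has distance 1 from every other term. -/
theorem tdist_strictIndir_le (x₀ : V) (t u : Term M.indirected V) :
    tdist (strictIndir x₀ t) (strictIndir x₀ u) ≤ tdist t u := by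
  by_cases h1 : t = var x₀ <;> by_cases h2 : u = var x₀
  · rw [h1, h2, tdist_self]
    exact unitInterval.nonneg'
  · rw [h1, tdist_var_of_ne h2]
    exact unitInterval.le_one'
  · rw [h2, tdist_comm t, tdist_var_of_ne h1]
    exact unitInterval.le_one'
  · rw [strictIndir_of_ne h1, strictIndir_of_ne h2, tdist_indir]

open Classical in
/-- The operations that interpret all symbols outside the range of `σ` by the variable `x₀`,
and make `I` strict in `x₀`. -/
def layerOp (σ : M.Hom N) (x₀ : V) : ∀ G : N.indirected.Symbol,
    (Fin (N.indirected.arity G) → Term M.indirected V) → Term M.indirected V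
  | none => fun ts => strictIndir x₀ (ts (0 : Fin 1))
  | some F => fun ts =>
    if h : ∃ F₀, σ.toFun F₀ = F then
      inApp h.choose fun i =>
        ts (Fin.cast ((σ.arity_eq h.choose).symm.trans (congrArg N.arity h.choose_spec)) i)
    else var x₀

theorem isNonexpansive_layerOp (σ : M.Hom N) (x₀ : V) : IsNonexpansive (layerOp σ x₀)
  | none, ts, us => tdist_strictIndir_le x₀ _ _
  | some F, ts, us => by
    by_cases h : ∃ F₀, σ.toFun F₀ = F
    -- Generalizing over the chosen preimage allows its defining equation to be eliminated by
    -- substitution.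
    · have key : ∀ F₀ (e : σ.toFun F₀ = F) (hc : M.arity F₀ = N.arity F),
          tdist (inApp F₀ fun i => ts (Fin.cast hc i))
            (inApp F₀ fun i => us (Fin.cast hc i)) ≤
          N.umm F fun i => tdist (ts i) (us i) := by
        rintro F₀ rfl hc
        exact ((tdist_inApp F₀ _ _).trans (σ.umm_eq F₀ fun i => tdist (ts i) (us i)).symm).le
      simp only [layerOp, dif_pos h]
      exact key _ h.choose_spec _
    · simp only [layerOp, dif_neg h, tdist_self]
      exact unitInterval.nonneg'

/-- The topmost part of a term that consists of symbols in the range of `σ`; the subterms with other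
root symbols are replaced by the variable `x₀`. -/
def layer (σ : M.Hom N) (x₀ : V) : Term N.indirected V → Term M.indirected V :=
  fold (layerOp σ x₀) var

variable {σ : M.Hom N} {x₀ : V}

theorem continuous_layer : Continuous (layer σ x₀) := continuous_fold

theorem layer_var (x : V) : layer σ x₀ (var x) = var x :=
  fold_var (isNonexpansive_layerOp σ x₀) x

theorem layer_indir (t : Term N.indirected V) :
    layer σ x₀ (indir t) = strictIndir x₀ (layer σ x₀ t) :=
  fold_app (isNonexpansive_layerOp σ x₀) none _

theorem layer_inApp_foreign {F : N.Symbol} (hF : F ∉ Set.range σ.toFun)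
    (ts : Fin (N.arity F) → Term N.indirected V) : layer σ x₀ (inApp F ts) = var x₀ := by
  refine (fold_app (isNonexpansive_layerOp σ x₀) (some F) ts).trans ?_
  simp only [layerOp]
  exact dif_neg hF

theorem layer_inApp (hσ : Function.Injective σ.toFun) (F : M.Symbol)
    (ts : Fin (N.arity (σ.toFun F)) → Term N.indirected V) :
    layer σ x₀ (inApp (σ.toFun F) ts) =
      inApp F fun i => layer σ x₀ (ts (Fin.cast (σ.arity_eq F).symm i)) := by
  refine (fold_app (isNonexpansive_layerOp σ x₀) (some (σ.toFun F)) ts).trans ?_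
  have h : ∃ F₀, σ.toFun F₀ = σ.toFun F := ⟨F, rfl⟩
  simp only [layerOp, dif_pos h]
  have key : ∀ (F₁ : M.Symbol) (e : F₁ = F) (hc : M.arity F₁ = N.arity (σ.toFun F)),
      inApp F₁ (fun i => layer σ x₀ (ts (Fin.cast hc i))) =
      inApp F fun i => layer σ x₀ (ts (Fin.cast (σ.arity_eq F).symm i)) := by
    rintro F₁ rfl hc
    rfl
  exact key _ (hσ h.choose_spec) _

/-- Strictness absorbs every `I` above `x₀`. Since only `I(x₀)` reduces to `x₀`, a genuine projected
step never ends in `x₀`. -/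
theorem layer_ne_indir_var (t : Term N.indirected V) : layer σ x₀ t ≠ indir (var x₀) := by
  rcases var_or_indir_or_inApp t with ⟨x, rfl⟩ | ⟨u, rfl⟩ | ⟨F, ts, rfl⟩
  · rw [layer_var]
    exact (indir_ne_var _ _).symm
  · rw [layer_indir]
    by_cases h : layer σ x₀ u = var x₀
    · rw [h, strictIndir_var]
      exact (indir_ne_var _ _).symm
    · rw [strictIndir_of_ne h]
      exact fun h' => h (indir_injective h')
  · refine ne_of_eq_of_ne (fold_app (isNonexpansive_layerOp σ x₀) (some F) ts) ?_
    simp only [layerOp]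
    split_ifs
    · exact inApp_ne_indir _ _ _
    · exact (indir_ne_var _ _).symm

theorem layer_iterate_indir {t : Term N.indirected V} (ht : layer σ x₀ t ≠ var x₀) (n : ℕ) :
    layer σ x₀ (indir^[n] t) = indir^[n] (layer σ x₀ t) := by
  induction n with
  | zero => rfl
  | succ n ih =>
    rw [Function.iterate_succ_apply', layer_indir, ih, Function.iterate_succ_apply', strictIndir_of_ne]
    cases n with
    | zero => exact ht
    | succ n =>
      rw [Function.iterate_succ_apply']
      exact indir_ne_var _ _

/-- A native rule contains neither `I` nor foreign symbols, so `layer` passes through it to the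
substitution, and instances of native rules project to instances of the same rules. -/
theorem layer_subst_map (hσ : Function.Injective σ.toFun) (θ : V → Term N.indirected V)
    (t : Term M V) :
    layer σ x₀ (subst θ (map N.toIndirected (map σ t))) =
      subst (fun x => layer σ x₀ (θ x)) (map M.toIndirected t) := by
  induction t using induction_of_isClosed with
  | hP =>
    exact isClosed_eq (continuous_layer.comp ((continuous_subst _).comp
      ((continuous_map _).comp (continuous_map _)))) ((continuous_subst _).comp (continuous_map _))
  | hvar x => rw [map_var, map_var, map_var, subst_var, subst_var]
  | happ F ts ih =>
    simp only [map_app σ, map_toIndirected_app, subst_inApp, layer_inApp hσ, Fin.cast_cast,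
      Fin.cast_eq_self, ih]

end Term

end Indirected

/-! ### Reductions of indirected systems -/

namespace ITRS

variable {V : Type u}

/-- The rewrite relation of the indirected version of `U`. -/
def IndirectedStep (U : ITRS V) (s t : Term U.sig.indirected V) : Prop :=
  U.indirected.Step s t

theorem stronglyConvergent_iff {U : ITRS V} :
    U.StronglyConvergent ↔ IsConvergent U.IndirectedStep :=
  Iff.rfl

/-! ### Steps of the indirected system and their inversion -/

namespace IndirectedStep

variable {U : ITRS V}

theorem rule {l r : Term U.sig V} (h : (l, r) ∈ U.rules) (θ : V → Term U.sig.indirected V) :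
    U.IndirectedStep (Term.subst θ (Term.map U.sig.toIndirected l))
      (Term.indir (Term.subst θ (Term.map U.sig.toIndirected r))) := by
  rw [← Term.subst_indir]
  exact Step.root (R := U.indirected) (Or.inl ⟨l, r, h, rfl⟩) θ

theorem collapse [Nonempty V] (t : Term U.sig.indirected V) :
    U.IndirectedStep (Term.indir t) t := by
  have x : V := Classical.arbitrary V
  have h : U.IndirectedStep (Term.subst (fun _ => t) (Term.indir (Term.var x)))
      (Term.subst (fun _ => t) (Term.var x)) :=
    Step.root (R := U.indirected) (Or.inr ⟨x, rfl⟩) fun _ => t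
  rwa [Term.subst_indir, Term.subst_var] at h

theorem indir {t u : Term U.sig.indirected V} (h : U.IndirectedStep t u) :
    U.IndirectedStep (Term.indir t) (Term.indir u) :=
  Step.app (R := U.indirected) none _ _ (0 : Fin 1) h fun j hj =>
    absurd (Subsingleton.elim (α := Fin 1) j 0) hj

theorem inApp (F : U.sig.Symbol) (ts us : Fin (U.sig.arity F) → Term U.sig.indirected V)
    (i : Fin (U.sig.arity F)) (h : U.IndirectedStep (ts i) (us i)) (hne : ∀ j ≠ i, ts j = us j) :
    U.IndirectedStep (Term.inApp F ts) (Term.inApp F us) :=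
  Step.app (R := U.indirected) (some F) ts us i h hne

theorem rec_on {P : Term U.sig.indirected V → Term U.sig.indirected V → Prop}
    (rule : ∀ l r, (l, r) ∈ U.rules → ∀ θ : V → Term U.sig.indirected V,
      P (Term.subst θ (Term.map U.sig.toIndirected l))
        (Term.indir (Term.subst θ (Term.map U.sig.toIndirected r))))
    (collapse : ∀ t, P (Term.indir t) t)
    (indir : ∀ t u, U.IndirectedStep t u → P t u → P (Term.indir t) (Term.indir u))
    (inApp : ∀ F ts us i, U.IndirectedStep (ts i) (us i) → P (ts i) (us i) →
      (∀ j ≠ i, ts j = us j) → P (Term.inApp F ts) (Term.inApp F us))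
    {s t : Term U.sig.indirected V} (h : U.IndirectedStep s t) : P s t := by
  refine Step.rec_on (R := U.indirected) ?_ ?_ h
  · rintro l r (⟨l', r', h, he⟩ | ⟨x, he⟩) θ
    all_goals obtain ⟨rfl, rfl⟩ := Prod.mk.inj he
    · exact (Term.subst_indir θ _).symm ▸ rule l' r' h θ
    · exact (Term.subst_indir θ (Term.var x)).symm ▸ collapse _
  · rintro (_ | F) ts us i h ih hne
    · obtain rfl : i = (0 : Fin 1) := Subsingleton.elim (α := Fin 1) i 0
      have h1 := Term.app_none (M := U.sig) ts
      have h2 := Term.app_none (M := U.sig) us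
      exact h1.symm ▸ h2.symm ▸ indir _ _ h ih
    · exact inApp F ts us i h ih hne

/-- Erasing indirections turns reductions of the indirected system into reductions. -/
theorem erase {s t : Term U.sig.indirected V} (h : U.IndirectedStep s t) :
    Term.erase s = Term.erase t ∨ U.Step (Term.erase s) (Term.erase t) := by
  refine rec_on (P := fun s t => Term.erase s = Term.erase t ∨
    U.Step (Term.erase s) (Term.erase t)) ?_ ?_ ?_ ?_ h
  · intro l r h θ
    rw [Term.erase_indir, Term.erase_subst_map, Term.erase_subst_map]
    exact Or.inr (Step.root h _)
  · exact fun t => Or.inl (Term.erase_indir t)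
  · intro t u _ ih
    rwa [Term.erase_indir, Term.erase_indir]
  · intro F ts us i _ ih hne
    rw [Term.erase_inApp, Term.erase_inApp]
    rcases ih with ih | ih
    · left
      congr 1
      funext j
      by_cases hj : j = i
      · rw [hj, ih]
      · rw [hne j hj]
    · exact Or.inr (Step.app F _ _ i ih fun j hj => by rw [hne j hj])

/-- A reduction that ends in a variable has the form `I(x) → x`. -/
theorem eq_indir_var {x : V} {s t : Term U.sig.indirected V} (h : U.IndirectedStep s t)
    (ht : t = Term.var x) : s = Term.indir (Term.var x) := by
  revert ht
  refine rec_on (P := fun s t => t = Term.var x → s = Term.indir (Term.var x)) ?_ ?_ ?_ ?_ h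
  · intro l r _ θ h
    exact absurd h (Term.indir_ne_var _ _)
  · rintro t rfl
    rfl
  · intro t u _ _ h
    exact absurd h (Term.indir_ne_var _ _)
  · intro F ts us i _ _ _ h
    exact absurd h (Term.inApp_ne_var _ _ _)

theorem ne_var {x : V} {s t : Term U.sig.indirected V} (h : U.IndirectedStep s t) :
    s ≠ Term.var x := by
  refine rec_on (P := fun s _ => s ≠ Term.var x) ?_ ?_ ?_ ?_ h
  · intro l r h θ
    obtain ⟨F, ts, rfl⟩ := exists_lhs_eq_app h
    rw [Term.map_toIndirected_app, Term.subst_inApp]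
    exact Term.inApp_ne_var _ _ _
  · exact fun t => Term.indir_ne_var _ _
  · exact fun t u _ _ => Term.indir_ne_var _ _
  · exact fun F ts us i _ _ _ => Term.inApp_ne_var _ _ _

/-- The step may also collapse the outer `I`; then `t` is `I(u)`, which reduces to `u` by collapsing
the next one. -/
theorem of_indir [Nonempty V] {t u : Term U.sig.indirected V}
    (h : U.IndirectedStep (Term.indir t) (Term.indir u)) : t = u ∨ U.IndirectedStep t u := by
  suffices H : ∀ s s', U.IndirectedStep s s' → s = Term.indir t → s' = Term.indir u →
    t = u ∨ U.IndirectedStep t u from H _ _ h rfl rfl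
  intro s s' h
  refine rec_on (P := fun s s' => s = Term.indir t → s' = Term.indir u →
    t = u ∨ U.IndirectedStep t u) ?_ ?_ ?_ ?_ h
  · intro l r h θ h1
    obtain ⟨F, ls, rfl⟩ := exists_lhs_eq_app h
    rw [Term.map_toIndirected_app, Term.subst_inApp] at h1
    exact absurd h1 (Term.inApp_ne_indir _ _ _)
  · intro t' h1 h2
    rw [← Term.indir_injective h1, h2]
    exact Or.inr (collapse _)
  · intro t' u' h _ h1 h2
    rw [← Term.indir_injective h1, ← Term.indir_injective h2]
    exact Or.inr h
  · intro F ts us i _ _ _ h1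
    exact absurd h1 (Term.inApp_ne_indir _ _ _)

/-- A step at the root either produces an `I` there or consumes one. Between two terms with roots
other than `I`, the step therefore lies in an argument. -/
theorem of_inApp {F : U.sig.Symbol} {ts us : Fin (U.sig.arity F) → Term U.sig.indirected V}
    (h : U.IndirectedStep (Term.inApp F ts) (Term.inApp F us)) (i : Fin (U.sig.arity F)) :
    ts i = us i ∨ U.IndirectedStep (ts i) (us i) := by
  suffices H : ∀ s s', U.IndirectedStep s s' → s = Term.inApp F ts → s' = Term.inApp F us →
    ts i = us i ∨ U.IndirectedStep (ts i) (us i) from H _ _ h rfl rfl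
  intro s s' h
  refine rec_on (P := fun s s' => s = Term.inApp F ts → s' = Term.inApp F us →
    ts i = us i ∨ U.IndirectedStep (ts i) (us i)) ?_ ?_ ?_ ?_ h
  · intro l r h θ _ h2
    exact absurd h2 (Term.indir_ne_inApp _ _ _)
  · intro t' h1
    exact absurd h1 (Term.indir_ne_inApp _ _ _)
  · intro t' u' _ _ h1
    exact absurd h1 (Term.indir_ne_inApp _ _ _)
  · intro G ts' us' j hj _ hne h1 h2
    obtain rfl := Term.inApp_inj_symbol h1
    rw [← Term.inApp_injective G h1, ← Term.inApp_injective G h2]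
    by_cases hij : i = j
    · rw [hij]
      exact Or.inr hj
    · exact Or.inl (hne i hij)

end IndirectedStep

/-- The system `R` is a layer of the system `U`: every rule of `U` is the translation of a rule of
`R`, or the root symbols of both its sides are foreign to `R`. -/
structure IsLayer (R U : ITRS V) (σ : R.sig.Hom U.sig) : Prop where
  injective : Function.Injective σ.toFun
  nonCollapsing : R.NonCollapsing
  rule : ∀ l r, (l, r) ∈ U.rules →
    (∃ l₀ r₀, (l₀, r₀) ∈ R.rules ∧ l = Term.map σ l₀ ∧ r = Term.map σ r₀) ∨
    ((∃ F ts, F ∉ Set.range σ.toFun ∧ l = Term.app F ts) ∧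
      ∃ F ts, F ∉ Set.range σ.toFun ∧ r = Term.app F ts)

theorem layer_subst_foreign {R U : ITRS V} {σ : R.sig.Hom U.sig} {x₀ : V} {F : U.sig.Symbol}
    (hF : F ∉ Set.range σ.toFun) (ts : Fin (U.sig.arity F) → Term U.sig V)
    (θ : V → Term U.sig.indirected V) :
    Term.layer σ x₀ (Term.subst θ (Term.map U.sig.toIndirected (Term.app F ts))) =
      Term.var x₀ := by
  rw [Term.map_toIndirected_app, Term.subst_inApp, Term.layer_inApp_foreign hF]

/-- Reductions of `U` project to reductions of a layer of `U`. -/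
theorem IsLayer.layer_step {R U : ITRS V} {σ : R.sig.Hom U.sig} (hl : IsLayer R U σ) (x₀ : V)
    {s t : Term U.sig.indirected V} (h : U.IndirectedStep s t) :
    Term.layer σ x₀ s = Term.layer σ x₀ t ∨
      R.IndirectedStep (Term.layer σ x₀ s) (Term.layer σ x₀ t) := by
  have : Nonempty V := ⟨x₀⟩
  refine IndirectedStep.rec_on (P := fun s t => Term.layer σ x₀ s = Term.layer σ x₀ t ∨
    R.IndirectedStep (Term.layer σ x₀ s) (Term.layer σ x₀ t)) ?_ ?_ ?_ ?_ h
  · intro l r h θ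
    rw [Term.layer_indir]
    rcases hl.rule l r h with ⟨l₀, r₀, h₀, rfl, rfl⟩ | ⟨⟨F, ts, hF, rfl⟩, G, us, hG, rfl⟩
    · right
      rw [Term.layer_subst_map hl.injective, Term.layer_subst_map hl.injective,
        Term.strictIndir_of_ne]
      · exact IndirectedStep.rule h₀ _
      -- The contractum has a native root, so its layer is not `x₀` and the new `I` is not absorbed.
      · obtain ⟨G, us, rfl⟩ := hl.nonCollapsing.exists_rhs_eq_app h₀
        rw [Term.map_toIndirected_app, Term.subst_inApp]
        exact Term.inApp_ne_var _ _ _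
    · left
      -- Redex and contractum both project to `x₀`, which absorbs the new `I`: the step is idle.
      rw [layer_subst_foreign hF, layer_subst_foreign hG, Term.strictIndir_var]
  · intro t
    rw [Term.layer_indir]
    by_cases h : Term.layer σ x₀ t = Term.var x₀
    · rw [h, Term.strictIndir_var]
      exact Or.inl rfl
    · rw [Term.strictIndir_of_ne h]
      exact Or.inr (IndirectedStep.collapse _)
  · intro t u _ ih
    rw [Term.layer_indir, Term.layer_indir]
    rcases ih with ih | ih
    · rw [ih]
      exact Or.inl rfl
    · right
      -- Neither side projects to `x₀`: a variable admits no step, and a step into `x₀` would start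
      -- from `I(x₀)`, which is not a layer.
      rw [Term.strictIndir_of_ne ih.ne_var, Term.strictIndir_of_ne fun ht =>
        Term.layer_ne_indir_var _ (ih.eq_indir_var ht)]
      exact ih.indir
  · intro F ts us i _ ih hne
    by_cases hF : F ∈ Set.range σ.toFun
    · obtain ⟨F, rfl⟩ := hF
      rw [Term.layer_inApp hl.injective, Term.layer_inApp hl.injective]
      rcases ih with ih | ih
      · left
        congr 1
        funext j
        by_cases hj : Fin.cast (σ.arity_eq F).symm j = i
        · rw [hj, ih]
        · rw [hne _ hj]
      · refine Or.inr (IndirectedStep.inApp F _ _ (Fin.cast (σ.arity_eq F) i) ih fun j hj => ?_)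
        rw [hne]
        rintro rfl
        exact hj rfl
    · left
      rw [Term.layer_inApp_foreign hF, Term.layer_inApp_foreign hF]

/-- Reduction sequences of the indirected system, possibly with idle steps. -/
abbrev IsLazyReduction (U : ITRS V) (α : Ordinal.{u}) (f : Ordinal.{u} → Term U.sig.indirected V) :
    Prop :=
  IsReductionSequence (fun s t => s = t ∨ U.IndirectedStep s t) α f

/-- Continuity descends to the arguments because `Term.inApp F` is inducing; steps descend by
`IndirectedStep.of_inApp`. -/
theorem IsLazyReduction.arg {U : ITRS V} {α : Ordinal.{u}}
    {f : Ordinal.{u} → Term U.sig.indirected V} (hf : U.IsLazyReduction α f) {F : U.sig.Symbol}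
    {g : Ordinal.{u} → Fin (U.sig.arity F) → Term U.sig.indirected V}
    (hg : ∀ β < α, f β = Term.inApp F (g β)) (i : Fin (U.sig.arity F)) :
    U.IsLazyReduction α fun β => g β i := by
  refine ⟨?_, fun β hβ => ?_⟩
  · have h1 : ContinuousOn (Term.inApp F ∘ g) (Set.Iio α) :=
      ContinuousOn.congr hf.isSequence fun β hβ => (hg β hβ).symm
    exact (continuous_apply i).comp_continuousOn ((Term.isInducing_inApp F).continuousOn_iff.2 h1)
  · have h := hf.step β hβ
    rw [hg β ((Order.lt_add_one_iff.2 le_rfl).trans hβ), hg _ hβ] at h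
    exact h.elim (fun h => Or.inl (congrFun (Term.inApp_injective F h) i)) fun h => h.of_inApp i

theorem IsLazyReduction.of_iterate_indir [Nonempty V] {U : ITRS V} {α : Ordinal.{u}} (n : ℕ) :
    ∀ {f g : Ordinal.{u} → Term U.sig.indirected V}, U.IsLazyReduction α f →
      (∀ β < α, f β = Term.indir^[n] (g β)) → U.IsLazyReduction α g := by
  induction n with
  | zero =>
    intro f g hf hg
    refine ⟨ContinuousOn.congr hf.isSequence fun β hβ => (hg β hβ).symm, fun β hβ => ?_⟩
    have := hf.step β hβ
    rwa [hg _ hβ, hg _ ((Order.lt_add_one_iff.2 le_rfl).trans hβ)] at this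
  | succ n ih =>
    intro f g hf hg
    refine ih (f := fun β => Term.indir^[n] (g β)) ⟨?_, fun β hβ => ?_⟩ fun β hβ => rfl
    · refine Term.isInducing_indir.continuousOn_iff.2 (ContinuousOn.congr hf.isSequence ?_)
      intro β hβ
      rw [Function.comp_apply, ← Function.iterate_succ_apply' Term.indir, hg β hβ]
    · have h := hf.step β hβ
      rw [hg _ hβ, hg _ ((Order.lt_add_one_iff.2 le_rfl).trans hβ), Function.iterate_succ_apply',
        Function.iterate_succ_apply'] at h
      exact h.elim (fun h => Or.inl (Term.indir_injective h)) IndirectedStep.of_indir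

theorem IsLayer.isLazyReduction {R U : ITRS V} {σ : R.sig.Hom U.sig} (hl : IsLayer R U σ) (x₀ : V)
    {α : Ordinal.{u}} {f : Ordinal.{u} → Term U.sig.indirected V} (hf : U.IsLazyReduction α f) :
    R.IsLazyReduction α fun β => Term.layer σ x₀ (f β) :=
  ⟨hf.isSequence.map Term.continuous_layer, fun β hβ => (hf.step β hβ).elim
    (fun h => Or.inl (congrArg _ h)) (hl.layer_step x₀)⟩

/-- If a layer contains the root symbols in a reduction sequence, up to symbols `I`, then the number
of these symbols `I` becomes stable. -/
theorem IsLayer.exists_stable {R U : ITRS V} {σ : R.sig.Hom U.sig} (hl : IsLayer R U σ) (x₀ : V)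
    (hR : R.StronglyConvergent) {α : Ordinal.{u}} (hα : Order.IsSuccLimit α)
    {f : Ordinal.{u} → Term U.sig.indirected V} (hf : U.IsLazyReduction α f)
    {n : Ordinal.{u} → ℕ} {c : Ordinal.{u} → Term U.sig.indirected V}
    (hn : ∀ β < α, f β = Term.indir^[n β] (c β))
    (hc : ∀ β < α, Term.layer σ x₀ (c β) ≠ Term.var x₀)
    (hc' : ∀ β < α, ∀ v, Term.layer σ x₀ (c β) ≠ Term.indir v) :
    ∃ b < α, ∀ β, b ≤ β → β < α → n β = n b := by
  have hl' := hl.isLazyReduction x₀ hf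
  obtain ⟨t, ht⟩ := (sequenceConverges_iff hα hl'.isSequence).1
    ((stronglyConvergent_iff.1 hR).stutter α _ hα hl')
  -- Two terms within 1/2 of the limit are at distance below 1, which suffices to compare their
  -- numbers of leading `I`s.
  obtain ⟨b, hb, H⟩ := ht (1 / 2) one_half_pos
  refine ⟨b, hb, fun β h1 h2 => ?_⟩
  refine Term.iterate_indir_eq_of_tdist_lt (hc' β h2) (hc' b hb) _ _ ?_
  rw [← Term.layer_iterate_indir (hc β h2), ← Term.layer_iterate_indir (hc b hb), ← hn β h2,
    ← hn b hb]
  change dist _ _ < (1 : ℝ)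
  have h3 := H β h1 h2
  have h4 := H b le_rfl hb
  have := dist_triangle_right (Term.layer σ x₀ (f β)) (Term.layer σ x₀ (f b)) t
  exact this.trans_lt ((add_lt_add h3 h4).trans_eq (add_halves 1))

end ITRS

/-! ### From stable roots to strong convergence -/

namespace ITRS

variable {V : Type u}

/-- If the terms of a lazy reduction are, up to symbols `I`, close to the finite term `s`, then they
are eventually close to each other. -/
theorem exists_tdist_mem [Nontrivial V] {U : ITRS V}
    (hlayer : ∃ (R : ITRS V) (σ : R.sig.Hom U.sig), IsLayer R U σ ∧ R.StronglyConvergent)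
    (hlayers : ∀ F, ∃ (R : ITRS V) (σ : R.sig.Hom U.sig),
      IsLayer R U σ ∧ R.StronglyConvergent ∧ F ∈ Set.range σ.toFun)
    {α : Ordinal.{u}} (hα : Order.IsSuccLimit α) (s : FinTerm U.sig V) :
    ∀ {L : Set unitInterval}, IsLowerSet L → ∀ {f : Ordinal.{u} → Term U.sig.indirected V},
      U.IsLazyReduction α f →
      (∀ β < α, Term.tdist (s : Term U.sig V) (Term.erase (f β)) ∈ L) →
      ∃ b < α, ∀ β γ, b ≤ β → β < α → b ≤ γ → γ < α → Term.tdist (f β) (f γ) ∈ L := by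
  have hα0 : (0 : Ordinal.{u}) < α := hα.bot_lt
  induction s with
  | var x =>
    intro L hL f hf hs
    have h0 : (0 : unitInterval) ∈ L := hL unitInterval.nonneg' (hs 0 hα0)
    -- If 1 is tolerated, every distance is. Otherwise the erased terms must have the same root as
    -- the finite term.
    by_cases h1 : (1 : unitInterval) ∈ L
    · exact ⟨0, hα0, fun _ _ _ _ _ _ => hL unitInterval.le_one' h1⟩
    have hroot : ∀ β < α, ∃ n : ℕ, f β = Term.indir^[n] (Term.var x) := by
      intro β hβ
      have he : Term.erase (f β) = Term.var x := by
        by_contra h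
        exact h1 (Term.tdist_var_of_ne h ▸ hs β hβ)
      obtain ⟨n, u, hu, ⟨y, rfl⟩ | ⟨F, ts, rfl⟩⟩ := Term.exists_eq_iterate_indir (f β)
      · rw [hu, Term.erase_iterate_indir, Term.erase_var] at he
        rw [← Term.var_injective he]
        exact ⟨n, hu⟩
      · rw [hu, Term.erase_iterate_indir, Term.erase_inApp] at he
        exact absurd he.symm (Term.var_ne_app _ _ _)
    choose! n hn using hroot
    obtain ⟨R, σ, hl, hR⟩ := hlayer
    -- The marker for foreign subterms must differ from `x`, or the symbols `I` above `x` would be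
    -- absorbed.
    obtain ⟨x₀, hx₀⟩ := exists_ne x
    have hv : Term.layer σ x₀ (Term.var x) = Term.var x := Term.layer_var x
    obtain ⟨b, hb, H⟩ := hl.exists_stable x₀ hR hα hf (c := fun _ => Term.var x) hn
      (fun β _ => hv ▸ fun h => hx₀ (Term.var_injective h).symm)
      fun β _ v => hv ▸ (Term.indir_ne_var v x).symm
    refine ⟨b, hb, fun β γ hβ hβ' hγ hγ' => ?_⟩
    rwa [hn β hβ', hn γ hγ', H β hβ hβ', H γ hγ hγ', Term.tdist_self]
  | app F ss ih =>
    intro L hL f hf hs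
    have h0 : (0 : unitInterval) ∈ L := hL unitInterval.nonneg' (hs 0 hα0)
    by_cases h1 : (1 : unitInterval) ∈ L
    · exact ⟨0, hα0, fun _ _ _ _ _ _ => hL unitInterval.le_one' h1⟩
    rw [← Term.app_coe] at hs
    have hroot : ∀ β < α, ∃ (n : ℕ) (ts : Fin (U.sig.arity F) → Term U.sig.indirected V),
        f β = Term.indir^[n] (Term.inApp F ts) := by
      intro β hβ
      have h := hs β hβ
      obtain ⟨n, u, hu, ⟨y, rfl⟩ | ⟨G, ts, rfl⟩⟩ := Term.exists_eq_iterate_indir (f β)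
      · rw [hu, Term.erase_iterate_indir, Term.erase_var, Term.tdist_comm,
          Term.tdist_var_app] at h
        exact absurd h h1
      · rw [hu, Term.erase_iterate_indir, Term.erase_inApp] at h
        by_cases hFG : F = G
        · subst hFG
          exact ⟨n, ts, hu⟩
        · rw [Term.tdist_app_ne hFG] at h
          exact absurd h h1
    have : Nonempty (Fin (U.sig.arity F) → Term U.sig.indirected V) :=
      ⟨(hroot 0 hα0).choose_spec.choose⟩
    choose! n g hg using hroot
    obtain ⟨R, σ, hl, hR, F₀, rfl⟩ := hlayers F
    have hlay : ∀ β, ∃ us, Term.layer σ (Classical.arbitrary V) (Term.inApp (σ.toFun F₀) (g β)) =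
        Term.inApp F₀ us := fun β => ⟨_, Term.layer_inApp hl.injective F₀ (g β)⟩
    obtain ⟨b, hb, H⟩ := hl.exists_stable (Classical.arbitrary V) hR hα hf
      (c := fun β => Term.inApp (σ.toFun F₀) (g β)) hg
      (fun β _ => by
        obtain ⟨us, h⟩ := hlay β
        exact h ▸ Term.inApp_ne_var _ _ _)
      fun β _ v => by
        obtain ⟨us, h⟩ := hlay β
        exact h ▸ Term.inApp_ne_indir _ _ _
    -- Freezing the sequence before `b` makes the number of leading `I`s constant on all of `α`, so
    -- that these `I`s and then `F` can be stripped.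
    have hmax : ∀ β < α, f (max β b) = Term.indir^[n b] (Term.inApp (σ.toFun F₀) (g (max β b))) :=
      fun β hβ => by rw [hg _ (max_lt hβ hb), H _ (le_max_right _ _) (max_lt hβ hb)]
    have hargs := IsLazyReduction.of_iterate_indir (n b) (hf.tail hb) hmax
    have hi : ∀ i, ∃ c < α, ∀ β γ, c ≤ β → β < α → c ≤ γ → γ < α →
        U.sig.umm (σ.toFun F₀)
          (Pi.single i (Term.tdist (g (max β b) i) (g (max γ b) i))) ∈ L := by
      intro i
      -- The tolerance for argument `i` is the preimage of `L` under the ultra-metric map with all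
      -- other coordinates 0; monotonicity makes it a lower set.
      refine ih i (L := {x | U.sig.umm (σ.toFun F₀) (Pi.single i x) ∈ L}) ?_
        (f := fun β => g (max β b) i) (hargs.arg (fun β _ => rfl) i) fun β hβ => ?_
      · intro x y hxy hx
        exact hL ((U.sig.isUltrametricMap _).monotone (Pi.single_mono i hxy)) hx
      · have h := hs _ (max_lt hβ hb)
        rw [hmax β hβ, Term.erase_iterate_indir, Term.erase_inApp, Term.tdist_app] at h
        refine hL ((U.sig.isUltrametricMap _).monotone fun j => ?_) h
        by_cases hj : j = i
        · subst hj
          rw [Pi.single_eq_same]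
        · rw [Pi.single_eq_of_ne hj]
          exact unitInterval.nonneg'
    choose c hc hcL using hi
    have hsup : Finset.univ.sup c < α := (Finset.sup_lt_iff hα0).2 fun i _ => hc i
    refine ⟨max b (Finset.univ.sup c), max_lt hb hsup, fun β γ hβ hβ' hγ hγ' => ?_⟩
    have hβb := max_eq_left ((le_max_left _ _).trans hβ)
    have hγb := max_eq_left ((le_max_left _ _).trans hγ)
    rw [← hβb, ← hγb, hmax β hβ', hmax γ hγ', Term.tdist_iterate_indir, Term.tdist_inApp]
    have hci : ∀ i, c i ≤ max b (Finset.univ.sup c) := fun i =>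
      (Finset.le_sup (f := c) (Finset.mem_univ i)).trans (le_max_right _ _)
    exact (U.sig.isUltrametricMap _).mem_of_single h0 _ fun i =>
      hcL i β γ ((hci i).trans hβ) hβ' ((hci i).trans hγ) hγ'

/-- A convergent system all of whose symbols belong to strongly convergent layers is strongly
convergent. -/
theorem Convergent.stronglyConvergent_of_layers [Nontrivial V] {U : ITRS V} (hU : U.Convergent)
    (hlayer : ∃ (R : ITRS V) (σ : R.sig.Hom U.sig), IsLayer R U σ ∧ R.StronglyConvergent)
    (hlayers : ∀ F, ∃ (R : ITRS V) (σ : R.sig.Hom U.sig),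
      IsLayer R U σ ∧ R.StronglyConvergent ∧ F ∈ Set.range σ.toFun) :
    U.StronglyConvergent := by
  rw [stronglyConvergent_iff]
  intro α f hα hf
  have hlazy : U.IsLazyReduction α f := ⟨hf.isSequence, fun β hβ => Or.inr (hf.step β hβ)⟩
  have he : IsReductionSequence (fun s t => s = t ∨ U.Step s t) α fun β => Term.erase (f β) :=
    ⟨hf.isSequence.map Term.continuous_erase, fun β hβ => (hf.step β hβ).erase⟩
  obtain ⟨t, ht⟩ := (sequenceConverges_iff hα he.isSequence).1 (IsConvergent.stutter hU α _ hα he)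
  refine (sequenceConverges_iff hα hf.isSequence).2 (exists_tendsToBelow hα fun ε hε => ?_)
  -- A finite term within `ε / 2` of the limit of the erased sequence, hence eventually within `ε`
  -- of the erased terms; it carries the structural induction.
  obtain ⟨s, hs⟩ := UniformSpace.Completion.denseRange_coe.exists_dist_lt t (half_pos hε)
  obtain ⟨b, hb, H⟩ := ht (ε / 2) (half_pos hε)
  obtain ⟨c, hc, hcL⟩ := exists_tdist_mem hlayer hlayers hα s (L := {x | (x : ℝ) < ε})
    (fun x y hxy hx => lt_of_le_of_lt (show (y : ℝ) ≤ x from hxy) hx) (hlazy.tail hb)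
    fun β hβ => by
      have h1 := H _ (le_max_right β b) (max_lt hβ hb)
      have h2 := dist_triangle_left (s : Term U.sig V) (Term.erase (f (max β b))) t
      rw [dist_comm] at h1
      exact h2.trans_lt ((add_lt_add hs h1).trans_eq (add_halves ε))
  refine ⟨max b c, max_lt hb hc, fun β γ hβ hβ' hγ hγ' => ?_⟩
  have h := hcL β γ ((le_max_right _ _).trans hβ) hβ' ((le_max_right _ _).trans hγ) hγ'
  rwa [max_eq_left ((le_max_left _ _).trans hβ), max_eq_left ((le_max_left _ _).trans hγ)] at h

/-- Both sides of a rule of `S` have a root symbol from `S`: the left one because it is not a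
variable, the right one because `S` is non-collapsing. -/
theorem isLayer_inl {R S : ITRS V} (hR : R.NonCollapsing) (hS : S.NonCollapsing) :
    IsLayer R (R.disjointUnion S) (R.sig.inl S.sig) where
  injective := Sum.inl_injective
  nonCollapsing := hR
  rule := by
    rintro l r (⟨⟨l', r'⟩, h, he⟩ | ⟨⟨l', r'⟩, h, he⟩)
    all_goals obtain ⟨rfl, rfl⟩ := Prod.mk.inj he
    · exact Or.inl ⟨l', r', h, rfl, rfl⟩
    · obtain ⟨F, ts, rfl⟩ := exists_lhs_eq_app h
      obtain ⟨G, us, rfl⟩ := hS.exists_rhs_eq_app h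
      exact Or.inr ⟨⟨Sum.inr F, _, fun ⟨_, h⟩ => Sum.inl_ne_inr h, Term.map_app _ F ts⟩,
        Sum.inr G, _, fun ⟨_, h⟩ => Sum.inl_ne_inr h, Term.map_app _ G us⟩

theorem isLayer_inr {R S : ITRS V} (hR : R.NonCollapsing) (hS : S.NonCollapsing) :
    IsLayer S (R.disjointUnion S) (R.sig.inr S.sig) where
  injective := Sum.inr_injective
  nonCollapsing := hS
  rule := by
    rintro l r (⟨⟨l', r'⟩, h, he⟩ | ⟨⟨l', r'⟩, h, he⟩)
    all_goals obtain ⟨rfl, rfl⟩ := Prod.mk.inj he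
    · obtain ⟨F, ts, rfl⟩ := exists_lhs_eq_app h
      obtain ⟨G, us, rfl⟩ := hR.exists_rhs_eq_app h
      exact Or.inr ⟨⟨Sum.inl F, _, fun ⟨_, h⟩ => Sum.inr_ne_inl h, Term.map_app _ F ts⟩,
        Sum.inl G, _, fun ⟨_, h⟩ => Sum.inr_ne_inl h, Term.map_app _ G us⟩
    · exact Or.inl ⟨l', r', h, rfl, rfl⟩

end ITRS

end InfRewriting

end

theorem mainTheorem4 {V : Type u} [Infinite V] (R S : InfRewriting.ITRS V)
    (hR : R.NonCollapsing) (hS : S.NonCollapsing)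
    (hR' : R.StronglyConvergent) (hS' : S.StronglyConvergent)
    (hRS : (R.disjointUnion S).Convergent) :
    (R.disjointUnion S).StronglyConvergent := by
  have hl := InfRewriting.ITRS.isLayer_inl hR hS
  have hr := InfRewriting.ITRS.isLayer_inr hR hS
  -- Of the infinitely many variables only two distinct ones are needed. The layer given here serves
  -- the positions of variables, where either component would do.
  refine hRS.stronglyConvergent_of_layers ⟨R, _, hl, hR'⟩ ?_
  rintro (F | F)
  · exact ⟨R, _, hl, hR', F, rfl⟩
  · exact ⟨S, _, hr, hS', F, rfl⟩
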